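/- Let $d\ge 1$ be an integer and let $p\ge 1$, $\alpha,\beta\in\mathbb R$. Integrals of nonnegative functions take values in $[0,\infty]$, and functions are real- or complex-valued. For $0<r<1$ put $$\Phi_{d}(r)=|\mathbb S^{d-2}|\int_{-1}^{1}\frac{(1-t^2)^{\frac{d-3}{2}}}{(1-2tr+r^2)^{\frac d2}}\,dt\quad(d\ge 2),\qquad \Phi_{1}(r)=(1-r)^{-1}+(1+r)^{-1},$$ where $|\mathbb S^{d-2}|$ is the surface area of the unit sphere of $\mathbb R^{d-1}$ (so $|\mathbb S^0|=2$). (a) Assume that $\alpha,\beta,\alpha+\beta\in(0,d)$. Then the integral $$\mathcal C_0=\int_0^1 r^{-1}\,(r^\alpha+r^\beta)\,\bigl|1-r^{\frac{d-\alpha-\beta}{p}}\bigr|^p\,\Phi_{d}(r)\,dr$$ converges, it is also given by $$\mathcal C_0=\frac{2\pi^{d/2}}{\Gamma(d/2)}\int_0^1\frac{(r^{\alpha-1}+r^{\beta-1})\bigl(1-r^{\frac{d-\alpha-\beta}{p}}\bigr)^p}{1-r^2}\,dr,$$ and for every continuous, compactly supported function $u$ on $\mathbb R^d$ $$\int_{\mathbb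 R^d}\int_{\mathbb R^d}\frac{|u(x)-u(y)|^p}{|x-y|^{d}}\,|x|^{-\alpha}|y|^{-\beta}\,dy\,dx\ \ge\ \mathcal C_0\int_{\mathbb R^d}\frac{|u(x)|^p}{|x|^{\alpha+\beta}}\,dx .$$ (b) Let $\mathbb R^d_+=\{x\in\mathbb R^d: x_d>0\}$ and assume that $\alpha,\beta,\alpha+\beta\in(-1,0)$. Then the integral in $$\mathcal D_0=\frac{\pi^{\frac{d-1}{2}}\,\Gamma(\frac12)}{\Gamma(\frac d2)}\int_0^1\frac{(t^\alpha+t^\beta)\,\bigl|1-t^{-\frac{1+\alpha+\beta}{p}}\bigr|^p}{1-t}\,dt$$ converges, and for every continuous function $u$ with compact support contained in $\mathbb R^d_+$ $$\int_{\mathbb R^d_+}\int_{\mathbb R^d_+}\frac{|u(x)-u(y)|^p}{|x-y|^{d}}\,x_d^{\alpha}\,y_d^{\beta}\,dy\,dx\ \ge\ \mathcal D_0\int_{\mathbb R^d_+}|u(x)|^p\,x_d^{\alpha+\beta}\,dx .$$ -/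

import Mathlib

open Set MeasureTheory

noncomputable section

/-- The surface area of the unit sphere of `ℝⁿ` (an `(n - 1)`-dimensional sphere), for `1 ≤ n`. -/
def unitSphereArea (n : ℕ) : ℝ :=
  ((volume : Measure (EuclideanSpace ℝ (Fin n))).toSphere).real univ

/-- The function `Φ_{d,s,p}(r)`, for `1 ≤ d`; the sphere in the case `2 ≤ d` is the
`(d - 2)`-dimensional one, i.e. the unit sphere of `ℝ^(d-1)`. -/
def hardyPhi (d : ℕ) (s p r : ℝ) : ℝ :=
  if 2 ≤ d then
    unitSphereArea (d - 1) *
      ∫ t in (-1 : ℝ)..1,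
        (1 - t ^ 2) ^ (((d : ℝ) - 3) / 2) / (1 - 2 * t * r + r ^ 2) ^ (((d : ℝ) + s * p) / 2)
  else
    (1 - r) ^ (-1 - s * p) + (1 + r) ^ (-1 - s * p)

/-- The integrand in the definition of the constant `𝒞(d,s,p,α,β)`. -/
def hardyCIntegrand (d : ℕ) (s p α β r : ℝ) : ℝ :=
  r ^ (s * p - 1) * (r ^ α + r ^ β) * |1 - r ^ (((d : ℝ) - α - β - s * p) / p)| ^ p *
    hardyPhi d s p r

/-- The constant `𝒞(d,s,p,α,β)` of the Hardy inequality on `ℝᵈ`. -/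
def hardyC (d : ℕ) (s p α β : ℝ) : ℝ :=
  ∫ r in (0 : ℝ)..1, hardyCIntegrand d s p α β r

/-- The integrand in the definition of the constant `𝒟(d,s,p,α,β)`. -/
def hardyDIntegrand (s p α β t : ℝ) : ℝ :=
  (t ^ α + t ^ β) * |1 - t ^ (-((1 + α + β - s * p) / p))| ^ p / (1 - t) ^ (1 + s * p)

/-- The constant `𝒟(d,s,p,α,β)` of the Hardy inequality on the half-space. -/
def hardyD (d : ℕ) (s p α β : ℝ) : ℝ :=
  Real.pi ^ (((d : ℝ) - 1) / 2) * Real.Gamma ((1 + s * p) / 2) /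
      Real.Gamma (((d : ℝ) + s * p) / 2) *
    ∫ t in (0 : ℝ)..1, hardyDIntegrand s p α β t

/-- The last coordinate `x_d` of `x ∈ ℝᵈ`, for `d ≥ 1`. -/
def lastCoord {d : ℕ} (hd : 0 < d) (x : EuclideanSpace ℝ (Fin d)) : ℝ :=
  x ⟨d - 1, Nat.sub_lt hd Nat.one_pos⟩

/-- The open upper half-space `{x ∈ ℝᵈ : x_d > 0}`. -/
def upperHalf {d : ℕ} (hd : 0 < d) : Set (EuclideanSpace ℝ (Fin d)) :=
  {x | 0 < lastCoord hd x}

end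

open scoped ENNReal

/-! Both inequalities are instances of one abstract Hardy inequality, `hardy_of_kernel`, for a
symmetric kernel `k` and a size function `σ`: the norm on the whole space, the last coordinate on
the half-space. Convexity of `x ↦ x ^ p` bounds `f x ^ p` by `f y ^ p` and the difference `g x y ^
p`, with a free parameter in `(0, 1)`. Taking this parameter to be `(σ x / σ y) ^ γ` makes `σ ^
(-γ)` the virtual extremal, and `γ * p = N + a + b` puts it at the borderline of integrability.

The bound is multiplied by the symmetrised weight and integrated over `σ x < σ y`. The `f x` and `f
y` terms become multiples `A` and `B` of the same weighted integral of `f ^ p`, and `A - B` is the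
Hardy constant. Since `B` may be infinite, ratios are first cut off at `δ < 1` (`hardy_truncated`);
then `δ` increases to 1.

What remains is to integrate the kernel over level sets of `σ`. For `|x - y|^(-d)`, polar
coordinates around `x` leave the measure `dl / l` on rays; adding opposite rays removes the
dependence on direction and gives the density `|S^(d-1)| / (1 - r^2)`. Points closer to the origin
are handled by inversion in a sphere. The same chord geometry evaluates `hardyPhi` at `s = 0`, which
yields the closed form of the constant. On the half-space, integrating over hyperplanes leaves a
multiple of `1 / |x_d - t|`, so that problem is one-dimensional. -/

/-! ### The convexity inequality and the radial weight. -/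

theorem one_sub_rpow_mul_rpow_le {p t A B G : ℝ} (hp : 1 ≤ p) (ht0 : 0 < t) (ht1 : t < 1)
    (hA : 0 ≤ A) (hB : 0 ≤ B) (hG : 0 ≤ G) (hABG : A ≤ B + G) :
    (1 - t) ^ (p - 1) * A ^ p ≤ G ^ p + (1 - t) ^ (p - 1) * (t ^ (1 - p) * B ^ p) := by
  have hs : 0 < 1 - t := by linarith
  -- `G + B` is the convex combination of `G / (1 - t)` and `B / t` with weights `1 - t` and `t`.
  -- Equality holds for `B = t * A`, `G = (1 - t) * A`.
  have hconv := (convexOn_rpow hp).2 (x := G / (1 - t)) (y := B / t)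
    (div_nonneg hG hs.le) (div_nonneg hB ht0.le) hs.le ht0.le (by ring)
  simp only [smul_eq_mul] at hconv
  rw [mul_div_cancel₀ _ hs.ne', mul_div_cancel₀ _ ht0.ne', Real.div_rpow hG hs.le,
    Real.div_rpow hB ht0.le] at hconv
  have hA' : A ^ p ≤ (G + B) ^ p := Real.rpow_le_rpow hA (by linarith) (by linarith)
  have e1 : (1 - t) ^ p = (1 - t) ^ (p - 1) * (1 - t) := by
    rw [← Real.rpow_add_one hs.ne', sub_add_cancel]
  have e2 : t ^ (1 - p) = t / t ^ p := by rw [Real.rpow_sub ht0, Real.rpow_one]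
  have hq : 0 < (1 - t) ^ (p - 1) := Real.rpow_pos_of_pos hs _
  have htp : 0 < t ^ p := Real.rpow_pos_of_pos ht0 _
  calc (1 - t) ^ (p - 1) * A ^ p
      ≤ (1 - t) ^ (p - 1) * ((1 - t) * (G ^ p / (1 - t) ^ p) + t * (B ^ p / t ^ p)) := by
        gcongr; exact hA'.trans hconv
    _ = _ := by rw [e1, e2]; field_simp

/-- The integrand of the sharp constant, with the angular weight `m` left abstract. -/
noncomputable def hardyWeight (p γ a b : ℝ) (r : ℝ) : ℝ :=
  (r ^ (-a - 1) + r ^ (-b - 1)) * (1 - r ^ γ) ^ p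

theorem one_sub_rpow_le_mul {r γ : ℝ} (hr : r ∈ Ioo (0 : ℝ) 1) :
    1 - r ^ γ ≤ max 1 γ * (1 - r) := by
  rcases le_total γ 1 with h | h
  · have : r ^ (1 : ℝ) ≤ r ^ γ := Real.rpow_le_rpow_of_exponent_ge hr.1 hr.2.le h
    rw [Real.rpow_one] at this
    rw [max_eq_left h]; linarith
  · have := one_add_mul_self_le_rpow_one_add (s := r - 1) (by linarith [hr.1]) h
    rw [max_eq_right h]
    rw [add_sub_cancel] at this
    linarith

theorem one_sub_rpow_mem {r γ : ℝ} (hγ : 0 < γ) (hr : r ∈ Ioo (0 : ℝ) 1) :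
    1 - r ^ γ ∈ Ioo (0 : ℝ) 1 :=
  ⟨by linarith [Real.rpow_lt_one hr.1.le hr.2 hγ], by linarith [Real.rpow_pos_of_pos hr.1 γ]⟩

/-- Near 1, `(1 - r ^ γ) ^ p ≤ 1 - r ^ γ` vanishes to first order and absorbs the pole of `m`; near
0, negativity of `a` and `b` makes the powers integrable. -/
theorem integrableOn_hardyWeight_mul {p γ a b κ : ℝ} (hp : 1 ≤ p) (hγ : 0 < γ) (ha : a < 0)
    (hb : b < 0) {m : ℝ → ℝ} (hm : Measurable m) (hm0 : ∀ r ∈ Ioo (0 : ℝ) 1, 0 ≤ m r)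
    (hm1 : ∀ r ∈ Ioo (0 : ℝ) 1, m r ≤ κ / (1 - r)) :
    IntegrableOn (fun r => hardyWeight p γ a b r * m r) (Ioo 0 1) := by
  have hint : IntegrableOn (fun r : ℝ => (r ^ (-a - 1) + r ^ (-b - 1)) * (max 1 γ * κ))
      (Ioo 0 1) := by
    have h : ∀ c : ℝ, c < 0 → IntegrableOn (fun r : ℝ => r ^ (-c - 1)) (Ioo 0 1) := fun c hc =>
      (intervalIntegral.integrableOn_Ioo_rpow_iff one_pos).2 (by linarith)
    exact ((h a ha).add (h b hb)).mul_const _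
  refine hint.mono' (by unfold hardyWeight; fun_prop) ?_
  refine (ae_restrict_iff' measurableSet_Ioo).2 (.of_forall fun r hr => ?_)
  have h1 := one_sub_rpow_mem hγ hr
  have hr1 : 0 < 1 - r := by linarith [hr.2]
  have hκ : 0 ≤ κ := by
    have := (hm0 r hr).trans (hm1 r hr)
    by_contra! h
    exact absurd this (not_le.2 (div_neg_of_neg_of_pos h hr1))
  have hw : 0 ≤ r ^ (-a - 1) + r ^ (-b - 1) := by
    have := Real.rpow_pos_of_pos hr.1 (-a - 1)
    have := Real.rpow_pos_of_pos hr.1 (-b - 1)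
    linarith
  have hpow : (1 - r ^ γ) ^ p ≤ 1 - r ^ γ := by
    simpa using Real.rpow_le_rpow_of_exponent_ge h1.1 h1.2.le hp
  have hpow0 : 0 ≤ (1 - r ^ γ) ^ p := Real.rpow_nonneg h1.1.le _
  rw [hardyWeight, Real.norm_of_nonneg (mul_nonneg (mul_nonneg hw hpow0) (hm0 r hr)), mul_assoc]
  refine mul_le_mul_of_nonneg_left ?_ hw
  calc (1 - r ^ γ) ^ p * m r ≤ (max 1 γ * (1 - r)) * (κ / (1 - r)) :=
        mul_le_mul (hpow.trans (one_sub_rpow_le_mul hr)) (hm1 r hr) (hm0 r hr) (by positivity)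
    _ = max 1 γ * κ := by field_simp

/-! ### The abstract Hardy inequality. -/

section Kernel

variable {X : Type*} [MeasurableSpace X] {μ : Measure X} [SFinite μ] {σ : X → ℝ}
  {k : X → X → ℝ≥0∞} {f : X → ℝ} {g : X → X → ℝ} {m : ℝ → ℝ} {N p γ a b κ δ : ℝ}

/-- Swapping the variables carries the second summand to the reflected region, which is disjoint
from the original one. What lies outside both is dropped, hence an inequality. -/
theorem lintegral_add_swap_le (hσ : Measurable σ) (hk : Measurable (Function.uncurry k))
    (hsymm : ∀ x y, k x y = k y x) {G : X → X → ℝ≥0∞} (hG : Measurable (Function.uncurry G)) :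
    ∫⁻ z in {z : X × X | 0 < σ z.1 ∧ σ z.1 < σ z.2}, (G z.1 z.2 + G z.2 z.1) * k z.1 z.2
      ∂(μ.prod μ) ≤ ∫⁻ x, ∫⁻ y, G x y * k x y ∂μ ∂μ := by
  have hG' : Measurable fun z : X × X => G z.1 z.2 := hG
  have hk' : Measurable fun z : X × X => k z.1 z.2 := hk
  have hGs : Measurable fun z : X × X => G z.2 z.1 := hG'.comp measurable_swap
  set S : Set (X × X) := {z : X × X | 0 < σ z.1 ∧ σ z.1 < σ z.2} with hS
  have hSm : MeasurableSet S :=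
    (measurableSet_lt measurable_const (hσ.comp measurable_fst)).inter
      (measurableSet_lt (hσ.comp measurable_fst) (hσ.comp measurable_snd))
  have hSm' : MeasurableSet (Prod.swap ⁻¹' S) := measurable_swap hSm
  simp_rw [add_mul]
  have hGk : Measurable fun z : X × X => G z.1 z.2 * k z.1 z.2 := hG'.mul hk'
  have hGsk : Measurable fun z : X × X => G z.2 z.1 * k z.1 z.2 := hGs.mul hk'
  rw [lintegral_add_left hGk]
  have h2 : ∫⁻ z in S, G z.2 z.1 * k z.1 z.2 ∂(μ.prod μ)
      = ∫⁻ z in Prod.swap ⁻¹' S, G z.1 z.2 * k z.1 z.2 ∂(μ.prod μ) := by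
    rw [← (Measure.measurePreserving_swap (μ := μ) (ν := μ)).setLIntegral_comp_preimage hSm hGsk]
    simp [hsymm]
  rw [h2, ← lintegral_union hSm']
  · refine (setLIntegral_le_lintegral _ _).trans_eq ?_
    rw [lintegral_prod _ hGk.aemeasurable]
  · rw [Set.disjoint_left]
    rintro z hz hz'
    exact absurd hz.2 (not_lt.2 hz'.2.le)

/-- Tonelli: the inner integral is the same constant `c` at every base point, so it factors out. The
next lemma does this with the roles of the variables exchanged. -/
theorem setLIntegral_prod_fst_mul (hσ : Measurable σ) (hpos : ∀ᵐ x ∂μ, 0 < σ x)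
    (hk : Measurable (Function.uncurry k)) {c : ℝ≥0∞} {F : ℝ → ℝ≥0∞} (hF : Measurable F)
    (h : ∀ x, 0 < σ x → ∫⁻ y in {y | σ x < σ y}, F (σ x / σ y) * k x y ∂μ = c)
    {P : X → ℝ≥0∞} (hP : Measurable P) :
    ∫⁻ z in {z : X × X | 0 < σ z.1 ∧ σ z.1 < σ z.2}, F (σ z.1 / σ z.2) * k z.1 z.2 * P z.1
      ∂(μ.prod μ) = c * ∫⁻ x, P x ∂μ := by
  have hk' : Measurable fun z : X × X => k z.1 z.2 := hk
  have hSm : MeasurableSet {z : X × X | 0 < σ z.1 ∧ σ z.1 < σ z.2} :=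
    (measurableSet_lt measurable_const (hσ.comp measurable_fst)).inter
      (measurableSet_lt (hσ.comp measurable_fst) (hσ.comp measurable_snd))
  rw [← lintegral_indicator hSm, lintegral_prod _ (by
    refine (Measurable.indicator ?_ hSm).aemeasurable; fun_prop), ← lintegral_const_mul _ hP]
  refine lintegral_congr_ae (hpos.mono fun x hx => ?_)
  dsimp only
  rw [← h x hx, ← lintegral_mul_const _ (by fun_prop),
    ← lintegral_indicator (measurableSet_lt measurable_const hσ)]
  refine lintegral_congr fun y => ?_
  simp [indicator, hx]

theorem setLIntegral_prod_snd_mul (hσ : Measurable σ) (hpos : ∀ᵐ x ∂μ, 0 < σ x)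
    (hk : Measurable (Function.uncurry k)) {c : ℝ≥0∞} {F : ℝ → ℝ≥0∞} (hF : Measurable F)
    (h : ∀ y, 0 < σ y → ∫⁻ x in {x | 0 < σ x ∧ σ x < σ y}, F (σ x / σ y) * k x y ∂μ = c)
    {P : X → ℝ≥0∞} (hP : Measurable P) :
    ∫⁻ z in {z : X × X | 0 < σ z.1 ∧ σ z.1 < σ z.2}, F (σ z.1 / σ z.2) * k z.1 z.2 * P z.2
      ∂(μ.prod μ) = c * ∫⁻ x, P x ∂μ := by
  have hk' : Measurable fun z : X × X => k z.1 z.2 := hk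
  have hSm : MeasurableSet {z : X × X | 0 < σ z.1 ∧ σ z.1 < σ z.2} :=
    (measurableSet_lt measurable_const (hσ.comp measurable_fst)).inter
      (measurableSet_lt (hσ.comp measurable_fst) (hσ.comp measurable_snd))
  rw [← lintegral_indicator hSm, lintegral_prod_symm _ (by
    refine (Measurable.indicator ?_ hSm).aemeasurable; fun_prop), ← lintegral_const_mul _ hP]
  refine lintegral_congr_ae (hpos.mono fun y hy => ?_)
  have hSy : MeasurableSet {x | 0 < σ x ∧ σ x < σ y} :=
    (measurableSet_lt measurable_const hσ).inter (measurableSet_lt hσ measurable_const)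
  dsimp only
  rw [← h y hy, ← lintegral_mul_const _ (by fun_prop), ← lintegral_indicator hSy]
  refine lintegral_congr fun x => ?_
  simp [indicator]

/-- The pointwise inequality behind the Hardy inequality. -/
theorem hardy_pointwise {p γ a b s t A B G : ℝ} (hp : 1 ≤ p) (hγ : 0 < γ) (hs : 0 < s)
    (hst : s < t) (hA : 0 ≤ A) (hB : 0 ≤ B) (hG : 0 ≤ G) (hABG : A ≤ B + G) :
    (1 - (s / t) ^ γ) ^ (p - 1) * ((s / t) ^ (-a) + (s / t) ^ (-b)) * (A ^ p * s ^ (a + b)) ≤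
      (G ^ p * (s ^ a * t ^ b) + G ^ p * (t ^ a * s ^ b)) +
      (1 - (s / t) ^ γ) ^ (p - 1) * (s / t) ^ (γ * (1 - p)) * ((s / t) ^ a + (s / t) ^ b) *
        (B ^ p * t ^ (a + b)) := by
  have ht : 0 < t := hs.trans hst
  have hr : s / t ∈ Ioo (0 : ℝ) 1 := ⟨div_pos hs ht, (div_lt_one ht).2 hst⟩
  -- The parameter `(s / t) ^ γ` is the ratio of the values of `σ ^ (-γ)` at the two points, so
  -- equality occurs for that profile.
  have key := one_sub_rpow_mul_rpow_le hp (Real.rpow_pos_of_pos hr.1 γ)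
    (Real.rpow_lt_one hr.1.le hr.2 hγ) hA hB hG hABG
  rw [← Real.rpow_mul hr.1.le] at key
  have pa := Real.rpow_pos_of_pos hs a
  have pb := Real.rpow_pos_of_pos hs b
  have qa := Real.rpow_pos_of_pos ht a
  have qb := Real.rpow_pos_of_pos ht b
  -- The symmetrised weight is written in two ways as a function of the ratio times a power of one
  -- variable: `s` for the `A` term, `t` for the `B` term.
  have e1 : ((s / t) ^ (-a) + (s / t) ^ (-b)) * s ^ (a + b) = s ^ a * t ^ b + t ^ a * s ^ b := by
    rw [Real.rpow_neg hr.1.le, Real.rpow_neg hr.1.le, Real.div_rpow hs.le ht.le,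
      Real.div_rpow hs.le ht.le, Real.rpow_add hs]
    field_simp
    ring
  have e2 : ((s / t) ^ a + (s / t) ^ b) * t ^ (a + b) = s ^ a * t ^ b + t ^ a * s ^ b := by
    rw [Real.div_rpow hs.le ht.le, Real.div_rpow hs.le ht.le, Real.rpow_add ht]
    field_simp
  have hw : 0 ≤ s ^ a * t ^ b + t ^ a * s ^ b := by positivity
  calc _ = (1 - (s / t) ^ γ) ^ (p - 1) * A ^ p *
        (((s / t) ^ (-a) + (s / t) ^ (-b)) * s ^ (a + b)) := by ring
    _ ≤ (G ^ p + (1 - (s / t) ^ γ) ^ (p - 1) * ((s / t) ^ (γ * (1 - p)) * B ^ p)) *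
        (s ^ a * t ^ b + t ^ a * s ^ b) := by
      rw [e1]; gcongr
    _ = (G ^ p * (s ^ a * t ^ b) + G ^ p * (t ^ a * s ^ b)) +
        (1 - (s / t) ^ γ) ^ (p - 1) * (s / t) ^ (γ * (1 - p)) * B ^ p *
          (s ^ a * t ^ b + t ^ a * s ^ b) := by ring
    _ = _ := by rw [← e2]; ring

/-- Below the cut-off `δ`, the density `m` is at most `|κ| / (1 - δ)`, so the coefficient of the `f
y` term is finite and may be cancelled. Without the cut-off, cancellation can fail: for `p = 1` and
`m` of order `1 / (1 - r)`, both coefficients are infinite. -/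
theorem hardy_truncated (hp : 1 ≤ p) (hγ : 0 < γ) (hγp : γ * p = N + a + b) (ha : a < 0)
    (hb : b < 0) (hδ : δ ∈ Ioo (0 : ℝ) 1) (hσ : Measurable σ) (hpos : ∀ᵐ x ∂μ, 0 < σ x)
    (hk : Measurable (Function.uncurry k)) (hsymm : ∀ x y, k x y = k y x)
    (hm : Measurable m) (hm0 : ∀ r ∈ Ioo (0 : ℝ) 1, 0 ≤ m r)
    (hm1 : ∀ r ∈ Ioo (0 : ℝ) 1, m r ≤ κ / (1 - r))
    (H1 : ∀ x, 0 < σ x → ∀ F : ℝ → ℝ≥0∞, Measurable F →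
      ∫⁻ y in {y | σ x < σ y}, F (σ x / σ y) * k x y ∂μ =
        ∫⁻ r in Ioo 0 1, F r * ENNReal.ofReal (m r * r⁻¹))
    (H2 : ∀ y, 0 < σ y → ∀ F : ℝ → ℝ≥0∞, Measurable F →
      ∫⁻ x in {x | 0 < σ x ∧ σ x < σ y}, F (σ x / σ y) * k x y ∂μ =
        ∫⁻ r in Ioo 0 1, F r * ENNReal.ofReal (m r * r ^ (N - 1)))
    (hf : Measurable f) (hf0 : ∀ x, 0 ≤ f x) (hg : Measurable (Function.uncurry g))
    (hg0 : ∀ x y, 0 ≤ g x y) (hgs : ∀ x y, g x y = g y x) (hfg : ∀ x y, f x ≤ f y + g x y)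
    (hfin : ∫⁻ x, ENNReal.ofReal (f x ^ p * σ x ^ (a + b)) ∂μ ≠ ∞) :
    (∫⁻ r in Ioo 0 δ, ENNReal.ofReal (hardyWeight p γ a b r * m r)) *
        ∫⁻ x, ENNReal.ofReal (f x ^ p * σ x ^ (a + b)) ∂μ ≤
      ∫⁻ x, ∫⁻ y, ENNReal.ofReal (g x y ^ p * (σ x ^ a * σ y ^ b)) * k x y ∂μ ∂μ := by
  set P : X → ℝ≥0∞ := fun x => ENNReal.ofReal (f x ^ p * σ x ^ (a + b)) with hP
  have hPm : Measurable P := by fun_prop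
  have hg' : Measurable fun z : X × X => g z.1 z.2 := hg
  have hk' : Measurable fun z : X × X => k z.1 z.2 := hk
  set F₁ : ℝ → ℝ≥0∞ := (Iio δ).indicator fun r =>
    ENNReal.ofReal ((1 - r ^ γ) ^ (p - 1) * (r ^ (-a) + r ^ (-b))) with hF₁
  set F₂ : ℝ → ℝ≥0∞ := (Iio δ).indicator fun r =>
    ENNReal.ofReal ((1 - r ^ γ) ^ (p - 1) * r ^ (γ * (1 - p)) * (r ^ a + r ^ b)) with hF₂
  have hF₁m : Measurable F₁ := Measurable.indicator (by fun_prop) measurableSet_Iio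
  have hF₂m : Measurable F₂ := Measurable.indicator (by fun_prop) measurableSet_Iio
  set A : ℝ≥0∞ := ∫⁻ r in Ioo 0 1, F₁ r * ENNReal.ofReal (m r * r⁻¹) with hA
  set B : ℝ≥0∞ := ∫⁻ r in Ioo 0 1, F₂ r * ENNReal.ofReal (m r * r ^ (N - 1)) with hB
  have hAI := setLIntegral_prod_fst_mul hσ hpos hk hF₁m (fun x hx => H1 x hx F₁ hF₁m) hPm
  have hBI := setLIntegral_prod_snd_mul hσ hpos hk hF₂m (fun x hx => H2 x hx F₂ hF₂m) hPm
  have hT := lintegral_add_swap_le (μ := μ) hσ hk hsymm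
    (G := fun x y => ENNReal.ofReal (g x y ^ p * (σ x ^ a * σ y ^ b))) (by
      change Measurable fun z : X × X => ENNReal.ofReal (g z.1 z.2 ^ p * (σ z.1 ^ a * σ z.2 ^ b))
      fun_prop)
  have hSm : MeasurableSet {z : X × X | 0 < σ z.1 ∧ σ z.1 < σ z.2} :=
    (measurableSet_lt measurable_const (hσ.comp measurable_fst)).inter
      (measurableSet_lt (hσ.comp measurable_fst) (hσ.comp measurable_snd))
  have hmain : A * ∫⁻ x, P x ∂μ ≤
      (∫⁻ x, ∫⁻ y, ENNReal.ofReal (g x y ^ p * (σ x ^ a * σ y ^ b)) * k x y ∂μ ∂μ) +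
        B * ∫⁻ x, P x ∂μ := by
    rw [hA, hB, ← hAI, ← hBI]
    refine le_trans ?_ (add_le_add_left hT _)
    rw [← lintegral_add_right _ (by fun_prop)]
    refine setLIntegral_mono' hSm fun z hz => ?_
    have hz2 : 0 < σ z.2 := hz.1.trans hz.2
    have hr : σ z.1 / σ z.2 ∈ Ioo (0 : ℝ) 1 := ⟨div_pos hz.1 hz2, (div_lt_one hz2).2 hz.2⟩
    have h1 := one_sub_rpow_mem hγ hr
    by_cases hzδ : σ z.1 / σ z.2 < δ
    · have key := hardy_pointwise (p := p) (γ := γ) (a := a) (b := b) hp hγ hz.1 hz.2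
        (hf0 z.1) (hf0 z.2) (hg0 z.1 z.2) (hfg z.1 z.2)
      have n1 : 0 ≤ (1 - (σ z.1 / σ z.2) ^ γ) ^ (p - 1) := Real.rpow_nonneg h1.1.le _
      have n2 : ∀ c : ℝ, 0 ≤ (σ z.1 / σ z.2) ^ c := fun c => Real.rpow_nonneg hr.1.le _
      have n3 : ∀ c : ℝ, 0 ≤ (σ z.1) ^ c := fun c => Real.rpow_nonneg hz.1.le _
      have n4 : ∀ c : ℝ, 0 ≤ (σ z.2) ^ c := fun c => Real.rpow_nonneg hz2.le _
      have n5 : 0 ≤ g z.1 z.2 ^ p := Real.rpow_nonneg (hg0 _ _) _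
      have n6 := Real.rpow_nonneg (hf0 z.1) p
      have n7 := Real.rpow_nonneg (hf0 z.2) p
      have m1 := add_nonneg (n2 (-a)) (n2 (-b))
      have m2 := add_nonneg (n2 a) (n2 b)
      have key' := ENNReal.ofReal_le_ofReal key
      rw [ENNReal.ofReal_mul (mul_nonneg n1 m1), ENNReal.ofReal_add (add_nonneg
        (mul_nonneg n5 (mul_nonneg (n3 _) (n4 _))) (mul_nonneg n5 (mul_nonneg (n4 _) (n3 _))))
        (mul_nonneg (mul_nonneg (mul_nonneg n1 (n2 _)) m2) (mul_nonneg n7 (n4 _))),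
        ENNReal.ofReal_add (mul_nonneg n5 (mul_nonneg (n3 _) (n4 _)))
        (mul_nonneg n5 (mul_nonneg (n4 _) (n3 _))),
        ENNReal.ofReal_mul (mul_nonneg (mul_nonneg n1 (n2 _)) m2)] at key'
      have e1 : F₁ (σ z.1 / σ z.2) = _ := indicator_of_mem (s := Iio δ) hzδ _
      have e2 : F₂ (σ z.1 / σ z.2) = _ := indicator_of_mem (s := Iio δ) hzδ _
      rw [e1, e2, hgs z.2 z.1]
      calc _ = k z.1 z.2 * (ENNReal.ofReal _ * ENNReal.ofReal _) := by
            rw [mul_right_comm, mul_comm]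
        _ ≤ _ := mul_le_mul_right key' _
        _ = _ := by ring
    · have e1 : F₁ (σ z.1 / σ z.2) = 0 := indicator_of_notMem (s := Iio δ) hzδ _
      simp [e1]
  -- By `γ * p = N + a + b`, the integrand of `B` is `r ^ γ` times that of `A`, with the roles of
  -- `a` and `b` exchanged. The difference supplies the missing factor `1 - r ^ γ`.
  have eAB : A = (∫⁻ r in Ioo 0 δ, ENNReal.ofReal (hardyWeight p γ a b r * m r)) + B := by
    have hsub : Ioo 0 δ = Iio δ ∩ Ioo 0 1 := by
      ext r; simp only [mem_Ioo, mem_inter_iff, mem_Iio]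
      constructor
      · intro h; exact ⟨h.2, h.1, h.2.trans hδ.2⟩
      · intro h; exact ⟨h.2.1, h.1⟩
    rw [hsub, ← Measure.restrict_restrict measurableSet_Iio,
      ← lintegral_indicator measurableSet_Iio, hA, hB, ← lintegral_add_right _ (by fun_prop)]
    refine setLIntegral_congr_fun measurableSet_Ioo fun r hr => ?_
    have h1 := one_sub_rpow_mem hγ hr
    by_cases hrδ : r < δ
    · have e1 : F₁ r = _ := indicator_of_mem (s := Iio δ) hrδ _
      have e2 : F₂ r = _ := indicator_of_mem (s := Iio δ) hrδ _
      have n1 : 0 ≤ (1 - r ^ γ) ^ (p - 1) := Real.rpow_nonneg h1.1.le _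
      have n1' : 0 ≤ (1 - r ^ γ) ^ p := Real.rpow_nonneg h1.1.le _
      have n2 : ∀ c : ℝ, 0 ≤ r ^ c := fun c => Real.rpow_nonneg hr.1.le _
      have n3 := hm0 r hr
      rw [e1, e2, indicator_of_mem (s := Iio δ) hrδ, hardyWeight, ← ENNReal.ofReal_mul (mul_nonneg n1
        (add_nonneg (n2 _) (n2 _))), ← ENNReal.ofReal_mul (mul_nonneg (mul_nonneg n1 (n2 _))
        (add_nonneg (n2 _) (n2 _))), ← ENNReal.ofReal_add (mul_nonneg (mul_nonneg
        (add_nonneg (n2 _) (n2 _)) n1') n3) (mul_nonneg (mul_nonneg (mul_nonneg n1 (n2 _))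
        (add_nonneg (n2 _) (n2 _))) (mul_nonneg n3 (n2 _)))]
      congr 1
      have q1 : (1 - r ^ γ) ^ p = (1 - r ^ γ) ^ (p - 1) * (1 - r ^ γ) := by
        rw [← Real.rpow_add_one h1.1.ne', sub_add_cancel]
      have q2 : ∀ c : ℝ, r ^ (-c - 1) = r ^ (-c) * r⁻¹ := fun c => by
        rw [Real.rpow_sub_one hr.1.ne', div_eq_mul_inv]
      have q3 : r ^ (γ * (1 - p)) * r ^ a * r ^ (N - 1) = r ^ γ * r ^ (-b - 1) := by
        rw [← Real.rpow_add hr.1, ← Real.rpow_add hr.1, ← Real.rpow_add hr.1]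
        congr 1; linear_combination -hγp
      have q4 : r ^ (γ * (1 - p)) * r ^ b * r ^ (N - 1) = r ^ γ * r ^ (-a - 1) := by
        rw [← Real.rpow_add hr.1, ← Real.rpow_add hr.1, ← Real.rpow_add hr.1]
        congr 1; linear_combination -hγp
      have q5 : (1 - r ^ γ) ^ (p - 1) * r ^ (γ * (1 - p)) * (r ^ a + r ^ b) *
          (m r * r ^ (N - 1)) = (1 - r ^ γ) ^ (p - 1) * m r *
            (r ^ γ * r ^ (-b - 1) + r ^ γ * r ^ (-a - 1)) := by
        rw [← q3, ← q4]; ring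
      rw [q5, q1, q2, q2]
      ring
    · have e1 : F₁ r = 0 := indicator_of_notMem (s := Iio δ) hrδ _
      have e2 : F₂ r = 0 := indicator_of_notMem (s := Iio δ) hrδ _
      simp [e1, e2, hrδ]
  have hBfin : B ≠ ∞ := by
    have hκ : ∀ r ∈ Ioo (0 : ℝ) 1, r < δ → m r ≤ |κ| / (1 - δ) := fun r hr hrδ =>
      (hm1 r hr).trans (by
        have : 0 < 1 - δ := by linarith [hδ.2]
        gcongr
        exact le_abs_self κ)
    have hint : IntegrableOn (fun r : ℝ => (r ^ (-a - 1) + r ^ (-b - 1)) * (|κ| / (1 - δ)))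
        (Ioo 0 1) := by
      have h : ∀ c : ℝ, c < 0 → IntegrableOn (fun r : ℝ => r ^ (-c - 1)) (Ioo 0 1) := fun c hc =>
        (intervalIntegral.integrableOn_Ioo_rpow_iff one_pos).2 (by linarith)
      exact ((h a ha).add (h b hb)).mul_const _
    refine (lt_of_le_of_lt (setLIntegral_mono' measurableSet_Ioo fun r hr => ?_)
      hint.lintegral_lt_top).ne
    by_cases hrδ : r < δ
    · have h1 := one_sub_rpow_mem hγ hr
      have e2 : F₂ r = _ := indicator_of_mem (s := Iio δ) hrδ _
      have n1 : 0 ≤ (1 - r ^ γ) ^ (p - 1) := Real.rpow_nonneg h1.1.le _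
      have n1' : (1 - r ^ γ) ^ (p - 1) ≤ 1 := Real.rpow_le_one h1.1.le h1.2.le (by linarith)
      have n2 : ∀ c : ℝ, 0 ≤ r ^ c := fun c => Real.rpow_nonneg hr.1.le _
      have n3 := hm0 r hr
      have n4 : r ^ γ ≤ 1 := by linarith [h1.1]
      rw [e2, ← ENNReal.ofReal_mul (mul_nonneg (mul_nonneg n1 (n2 _))
        (add_nonneg (n2 _) (n2 _)))]
      refine ENNReal.ofReal_le_ofReal ?_
      have q3 : r ^ (γ * (1 - p)) * r ^ a * r ^ (N - 1) = r ^ γ * r ^ (-b - 1) := by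
        rw [← Real.rpow_add hr.1, ← Real.rpow_add hr.1, ← Real.rpow_add hr.1]
        congr 1; linear_combination -hγp
      have q4 : r ^ (γ * (1 - p)) * r ^ b * r ^ (N - 1) = r ^ γ * r ^ (-a - 1) := by
        rw [← Real.rpow_add hr.1, ← Real.rpow_add hr.1, ← Real.rpow_add hr.1]
        congr 1; linear_combination -hγp
      calc _ = (r ^ γ * ((1 - r ^ γ) ^ (p - 1))) *
              ((r ^ (-a - 1) + r ^ (-b - 1)) * m r) := by
            linear_combination (1 - r ^ γ) ^ (p - 1) * m r * (q3 + q4)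
        _ ≤ 1 * ((r ^ (-a - 1) + r ^ (-b - 1)) * (|κ| / (1 - δ))) :=
            mul_le_mul (mul_le_one₀ n4 n1 n1') (mul_le_mul_of_nonneg_left (hκ r hr hrδ)
              (add_nonneg (n2 _) (n2 _))) (mul_nonneg (add_nonneg (n2 _) (n2 _)) n3) zero_le_one
        _ = _ := one_mul _
    · have e2 : F₂ r = 0 := indicator_of_notMem (s := Iio δ) hrδ _
      simp [e2]
  rw [eAB, add_mul] at hmain
  exact (ENNReal.add_le_add_iff_right (ENNReal.mul_ne_top hBfin hfin)).1 hmain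

/-- An abstract weighted fractional Hardy inequality: `σ` is the size of a point, and `m` describes
the integrals of the kernel `k` over level sets of `σ`. -/
theorem hardy_of_kernel (hp : 1 ≤ p) (hγ : 0 < γ) (hγp : γ * p = N + a + b) (ha : a < 0)
    (hb : b < 0) (hσ : Measurable σ) (hpos : ∀ᵐ x ∂μ, 0 < σ x)
    (hk : Measurable (Function.uncurry k)) (hsymm : ∀ x y, k x y = k y x)
    (hm : Measurable m) (hm0 : ∀ r ∈ Ioo (0 : ℝ) 1, 0 ≤ m r)
    (hm1 : ∀ r ∈ Ioo (0 : ℝ) 1, m r ≤ κ / (1 - r))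
    (H1 : ∀ x, 0 < σ x → ∀ F : ℝ → ℝ≥0∞, Measurable F →
      ∫⁻ y in {y | σ x < σ y}, F (σ x / σ y) * k x y ∂μ =
        ∫⁻ r in Ioo 0 1, F r * ENNReal.ofReal (m r * r⁻¹))
    (H2 : ∀ y, 0 < σ y → ∀ F : ℝ → ℝ≥0∞, Measurable F →
      ∫⁻ x in {x | 0 < σ x ∧ σ x < σ y}, F (σ x / σ y) * k x y ∂μ =
        ∫⁻ r in Ioo 0 1, F r * ENNReal.ofReal (m r * r ^ (N - 1)))
    (hf : Measurable f) (hf0 : ∀ x, 0 ≤ f x) (hg : Measurable (Function.uncurry g))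
    (hg0 : ∀ x y, 0 ≤ g x y) (hgs : ∀ x y, g x y = g y x) (hfg : ∀ x y, f x ≤ f y + g x y)
    (hfin : ∫⁻ x, ENNReal.ofReal (f x ^ p * σ x ^ (a + b)) ∂μ ≠ ∞) :
    ENNReal.ofReal (∫ r in Ioo 0 1, hardyWeight p γ a b r * m r) *
        ∫⁻ x, ENNReal.ofReal (f x ^ p * σ x ^ (a + b)) ∂μ ≤
      ∫⁻ x, ∫⁻ y, ENNReal.ofReal (g x y ^ p * (σ x ^ a * σ y ^ b)) * k x y ∂μ ∂μ := by
  have hint := integrableOn_hardyWeight_mul hp hγ ha hb hm hm0 hm1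
  have hnn : ∀ r ∈ Ioo (0 : ℝ) 1, 0 ≤ hardyWeight p γ a b r * m r := fun r hr =>
    mul_nonneg (mul_nonneg (add_nonneg (Real.rpow_nonneg hr.1.le _) (Real.rpow_nonneg hr.1.le _))
      (Real.rpow_nonneg (one_sub_rpow_mem hγ hr).1.le _)) (hm0 r hr)
  rw [ofReal_integral_eq_lintegral_ofReal hint
    ((ae_restrict_iff' measurableSet_Ioo).2 (.of_forall hnn))]
  -- The shift by 2 keeps `δ 0 = 1 / 2` strictly inside the unit interval.
  set δ : ℕ → ℝ := fun n => 1 - 1 / ((n : ℝ) + 2) with hδ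
  have hδmono : Monotone δ := fun i j hij => by
    have : (i : ℝ) ≤ j := by exact_mod_cast hij
    simp only [hδ]; gcongr
  have hδmem : ∀ n, δ n ∈ Ioo (0 : ℝ) 1 := fun n => by
    have h2 : (0 : ℝ) < (n : ℝ) + 2 := by positivity
    constructor
    · simp only [hδ, sub_pos]; rw [div_lt_one h2]; linarith [n.cast_nonneg (α := ℝ)]
    · simp only [hδ]; linarith [div_pos one_pos h2]
  have hU : Ioo (0 : ℝ) 1 = ⋃ n, Ioo 0 (δ n) := by
    ext r
    simp only [mem_Ioo, mem_iUnion]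
    constructor
    · rintro ⟨h0, h1⟩
      obtain ⟨n, hn⟩ := exists_nat_one_div_lt (sub_pos.2 h1)
      refine ⟨n, h0, ?_⟩
      have : 1 / ((n : ℝ) + 2) ≤ 1 / ((n : ℝ) + 1) := by gcongr; norm_num
      simp only [hδ]; linarith
    · rintro ⟨n, h0, h1⟩
      exact ⟨h0, h1.trans (hδmem n).2⟩
  rw [hU, setLIntegral_iUnion_of_directed _ (Monotone.directed_le fun i j hij =>
    Ioo_subset_Ioo_right (hδmono hij)), ENNReal.iSup_mul]
  exact iSup_le fun n => hardy_truncated hp hγ hγp ha hb (hδmem n) hσ hpos hk hsymm hm hm0 hm1 H1 H2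
    hf hf0 hg hg0 hgs hfg hfin

end Kernel

/-! ### Radial substitutions and integration along lines. -/

theorem setLIntegral_Ioi_eq_inv {R : ℝ} (hR : 0 < R) (G : ℝ → ℝ≥0∞) :
    ∫⁻ s in Ioi R, G s = ∫⁻ r in Ioo (0 : ℝ) 1, ENNReal.ofReal (R / r ^ 2) * G (R / r) := by
  have himg : (fun r : ℝ => R / r) '' Ioo 0 1 = Ioi R := by
    ext s
    simp only [mem_image, mem_Ioo, mem_Ioi]
    constructor
    · rintro ⟨r, ⟨h0, h1⟩, rfl⟩
      rw [lt_div_iff₀ h0]; nlinarith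
    · intro h
      have hs : 0 < s := hR.trans h
      exact ⟨R / s, ⟨div_pos hR hs, (div_lt_one hs).2 h⟩, by field_simp⟩
  rw [← himg, lintegral_image_eq_lintegral_abs_deriv_mul measurableSet_Ioo
    (f' := fun r => -(R / r ^ 2))]
  · refine setLIntegral_congr_fun measurableSet_Ioo fun r hr => ?_
    have : 0 ≤ R / r ^ 2 := by positivity
    simp only [abs_neg, abs_of_nonneg this]
  · intro r hr
    have := ((hasDerivAt_inv hr.1.ne').const_mul R).hasDerivWithinAt (s := Ioo 0 1)
    simp only [div_eq_mul_inv]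
    convert! this using 1
    ring
  · intro r hr s hs h
    have h0 := hr.1.ne'
    have h1 := hs.1.ne'
    have := hR.ne'
    simp only at h
    field_simp at h
    exact h.symm

theorem setLIntegral_Ioo_eq_mul {R : ℝ} (hR : 0 < R) (G : ℝ → ℝ≥0∞) :
    ∫⁻ s in Ioo 0 R, G s = ∫⁻ r in Ioo (0 : ℝ) 1, ENNReal.ofReal R * G (R * r) := by
  have himg : (fun r : ℝ => R * r) '' Ioo 0 1 = Ioo 0 R := by
    ext s
    simp only [mem_image, mem_Ioo]
    constructor
    · rintro ⟨r, ⟨h0, h1⟩, rfl⟩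
      exact ⟨mul_pos hR h0, by nlinarith⟩
    · intro h
      exact ⟨s / R, ⟨div_pos h.1 hR, (div_lt_one hR).2 h.2⟩, by field_simp⟩
  rw [← himg, lintegral_image_eq_lintegral_abs_deriv_mul measurableSet_Ioo (f' := fun _ => R)]
  · rw [abs_of_pos hR]
  · intro r hr
    simpa using ((hasDerivAt_id r).const_mul R).hasDerivWithinAt (s := Ioo 0 1)
  · intro r _ s _ h
    exact mul_left_cancel₀ hR.ne' h

/-- Integration along a ray that starts in the closed ball of radius `R`, in terms of the distance
to the centre, outside that ball. -/
theorem lintegral_ray {R c : ℝ} (hR : 0 < R) (G : ℝ → ℝ≥0∞) :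
    ∫⁻ l in {l : ℝ | 0 < l ∧ 0 < l + 2 * c},
        ENNReal.ofReal l⁻¹ * G √(R ^ 2 + 2 * c * l + l ^ 2) =
      ∫⁻ s in Ioi R, ENNReal.ofReal
        (s / (√(s ^ 2 - R ^ 2 + c ^ 2) * (√(s ^ 2 - R ^ 2 + c ^ 2) - c))) * G s := by
  have hq : ∀ s ∈ Ioi R, |c| < √(s ^ 2 - R ^ 2 + c ^ 2) := fun s hs => by
    refine Real.lt_sqrt_of_sq_lt ?_
    rw [sq_abs]
    have : R < s := hs
    nlinarith
  have hq2 : ∀ s ∈ Ioi R, √(s ^ 2 - R ^ 2 + c ^ 2) ^ 2 = s ^ 2 - R ^ 2 + c ^ 2 := fun s hs => by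
    have : R < s := hs
    exact Real.sq_sqrt (by nlinarith [sq_nonneg c])
  -- Substitution of the distance `s` for `l`: this is the larger root of `l ^ 2 + 2 * c * l + R ^ 2
  -- = s ^ 2`.
  have himg : (fun s : ℝ => √(s ^ 2 - R ^ 2 + c ^ 2) - c) '' Ioi R =
      {l : ℝ | 0 < l ∧ 0 < l + 2 * c} := by
    ext l
    simp only [mem_image, mem_Ioi, mem_ofPred_eq]
    constructor
    · rintro ⟨s, hs, rfl⟩
      have := abs_lt.1 (hq s hs)
      constructor <;> linarith [this.1, this.2]
    · rintro ⟨h1, h2⟩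
      refine ⟨√(R ^ 2 + 2 * c * l + l ^ 2), Real.lt_sqrt_of_sq_lt (by nlinarith), ?_⟩
      rw [Real.sq_sqrt (by nlinarith), show R ^ 2 + 2 * c * l + l ^ 2 - R ^ 2 + c ^ 2 =
        (l + c) ^ 2 by ring, Real.sqrt_sq (by linarith)]
      ring
  rw [← himg, lintegral_image_eq_lintegral_abs_deriv_mul measurableSet_Ioi
    (f' := fun s => s / √(s ^ 2 - R ^ 2 + c ^ 2))]
  · refine setLIntegral_congr_fun measurableSet_Ioi fun s hs => ?_
    have hs' : R < s := hs
    have h := abs_lt.1 (hq s hs)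
    have h0 : 0 < √(s ^ 2 - R ^ 2 + c ^ 2) := (abs_nonneg c).trans_lt (hq s hs)
    have h1 : 0 ≤ s / √(s ^ 2 - R ^ 2 + c ^ 2) := div_nonneg (hR.trans hs').le h0.le
    rw [abs_of_nonneg h1, ← mul_assoc, ← ENNReal.ofReal_mul h1]
    congr 2
    · have : √(s ^ 2 - R ^ 2 + c ^ 2) - c ≠ 0 := by linarith [h.2]
      field_simp
    · rw [show R ^ 2 + 2 * c * (√(s ^ 2 - R ^ 2 + c ^ 2) - c) + (√(s ^ 2 - R ^ 2 + c ^ 2) - c) ^ 2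
        = R ^ 2 + (√(s ^ 2 - R ^ 2 + c ^ 2) ^ 2 - c ^ 2) by ring, hq2 s hs,
        show R ^ 2 + (s ^ 2 - R ^ 2 + c ^ 2 - c ^ 2) = s ^ 2 by ring,
        Real.sqrt_sq (hR.trans hs').le]
  · intro s hs
    have hs' : R < s := hs
    have h0 : s ^ 2 - R ^ 2 + c ^ 2 ≠ 0 := by nlinarith [sq_nonneg c]
    have := ((((hasDerivAt_pow 2 s).sub_const (R ^ 2)).add_const (c ^ 2)).sqrt h0).sub_const c
    convert! this.hasDerivWithinAt using 1
    field_simp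
    simp [mul_comm]
  · intro s hs t ht h
    have hs' : R < s := hs
    have ht' : R < t := ht
    have h1 : √(s ^ 2 - R ^ 2 + c ^ 2) = √(t ^ 2 - R ^ 2 + c ^ 2) := by simpa using h
    have h2 : s ^ 2 = t ^ 2 := by
      have := hq2 s hs
      rw [h1, hq2 t ht] at this
      linarith
    exact (sq_eq_sq₀ (hR.trans hs').le (hR.trans ht').le).1 h2

/-- Integration along a line through a point of the closed ball of radius `R`, outside of that
ball: the result does not depend on the direction of the line. -/
theorem lintegral_line {R c : ℝ} (hR : 0 < R) {F : ℝ → ℝ≥0∞} (hF : Measurable F) :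
    (∫⁻ l in {l : ℝ | 0 < l ∧ 0 < l + 2 * c},
        ENNReal.ofReal l⁻¹ * F (R / √(R ^ 2 + 2 * c * l + l ^ 2))) +
      ∫⁻ l in {l : ℝ | 0 < l ∧ 0 < l + 2 * -c},
        ENNReal.ofReal l⁻¹ * F (R / √(R ^ 2 + 2 * -c * l + l ^ 2)) =
      ∫⁻ r in Ioo (0 : ℝ) 1, 2 * (F r * ENNReal.ofReal ((1 - r ^ 2)⁻¹ * r⁻¹)) := by
  have h1 := lintegral_ray (c := c) hR fun s => F (R / s)
  have h2 := lintegral_ray (c := -c) hR fun s => F (R / s)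
  rw [h1, h2, ← lintegral_add_left (by fun_prop), setLIntegral_Ioi_eq_inv hR]
  refine setLIntegral_congr_fun measurableSet_Ioo fun r hr => ?_
  have h0 := hr.1
  have hr2 : 0 < 1 - r ^ 2 := by nlinarith [hr.2]
  have hpos : 0 < (R / r) ^ 2 - R ^ 2 := by
    have : (R / r) ^ 2 - R ^ 2 = R ^ 2 * (1 - r ^ 2) / r ^ 2 := by field_simp
    rw [this]; positivity
  rw [neg_sq, ← add_mul]
  set q := √((R / r) ^ 2 - R ^ 2 + c ^ 2) with hq
  have hq2 : q ^ 2 = (R / r) ^ 2 - R ^ 2 + c ^ 2 := Real.sq_sqrt (by nlinarith [sq_nonneg c])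
  have hqc : |c| < q := Real.lt_sqrt_of_sq_lt (by rw [sq_abs]; linarith)
  have hq0 : 0 < q := (abs_nonneg c).trans_lt hqc
  have h1 : 0 < q - c := by linarith [(abs_lt.1 hqc).2]
  have h2 : 0 < q + c := by linarith [(abs_lt.1 hqc).1]
  have hRr : 0 < R / r := by positivity
  rw [sub_neg_eq_add, ← ENNReal.ofReal_add (by positivity) (by positivity), ← mul_assoc,
    ← ENNReal.ofReal_mul (by positivity), show R / (R / r) = r by field_simp, mul_comm _ (F r),
    mul_left_comm, ← ENNReal.ofReal_ofNat, ← ENNReal.ofReal_mul (by positivity)]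
  congr 2
  -- The two opposite rays combine so that only `q ^ 2 - c ^ 2 = (R / r) ^ 2 - R ^ 2` survives,
  -- which is free of `c`.
  have e : R / r / (q * (q - c)) + R / r / (q * (q + c)) = 2 * (R / r) / (q ^ 2 - c ^ 2) := by
    have : q ^ 2 - c ^ 2 ≠ 0 := by rw [hq2]; linarith
    have e3 : q ^ 2 - c ^ 2 = (q - c) * (q + c) := by ring
    rw [e3]
    field_simp
    ring
  rw [e, hq2, show (R / r) ^ 2 - R ^ 2 + c ^ 2 - c ^ 2 = R ^ 2 * (1 - r ^ 2) / r ^ 2 by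
    field_simp; ring]
  field_simp

/-! ### The kernel `|x - y|^(-d)` integrated over spheres. -/

section Polar

/-- Since `‖x + l • ω‖ ^ 2 - ‖x‖ ^ 2 = l * (l + 2 * ⟪x, ω⟫)`, the part of the ray outside the ball
is the domain used in `lintegral_ray`. -/
theorem setLIntegral_ray_norm {E : Type*} [NormedAddCommGroup E] [InnerProductSpace ℝ E] {x ω : E} (hω : ‖ω‖ = 1) {F : ℝ → ℝ≥0∞} :
    ∫⁻ l in Ioi (0 : ℝ), ENNReal.ofReal l⁻¹ *
        {y : E | ‖x‖ < ‖y‖}.indicator (fun y => F (‖x‖ / ‖y‖)) (x + l • ω) =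
      ∫⁻ l in {l : ℝ | 0 < l ∧ 0 < l + 2 * inner ℝ x ω},
        ENNReal.ofReal l⁻¹ * F (‖x‖ / √(‖x‖ ^ 2 + 2 * inner ℝ x ω * l + l ^ 2)) := by
  have hm : MeasurableSet {l : ℝ | 0 < l ∧ 0 < l + 2 * inner ℝ x ω} :=
    (measurableSet_lt measurable_const measurable_id).inter
      (measurableSet_lt measurable_const (measurable_id.add_const _))
  rw [← lintegral_indicator measurableSet_Ioi, ← lintegral_indicator hm]
  refine lintegral_congr fun l => ?_
  by_cases hl : 0 < l
  · have hn : ‖x + l • ω‖ ^ 2 = ‖x‖ ^ 2 + 2 * inner ℝ x ω * l + l ^ 2 := by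
      rw [norm_add_sq_real, inner_smul_right, norm_smul, hω, mul_one, Real.norm_eq_abs, sq_abs]
      ring
    have hn' : ‖x + l • ω‖ = √(‖x‖ ^ 2 + 2 * inner ℝ x ω * l + l ^ 2) := by
      rw [← hn, Real.sqrt_sq (norm_nonneg _)]
    have hiff : ‖x‖ < ‖x + l • ω‖ ↔ 0 < l + 2 * inner ℝ x ω := by
      rw [← sq_lt_sq₀ (norm_nonneg _) (norm_nonneg _), hn]
      constructor
      · intro h; by_contra! h'; nlinarith
      · intro h; nlinarith
    by_cases h : 0 < l + 2 * inner ℝ x ω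
    · rw [indicator_of_mem (by exact hl), indicator_of_mem (by exact hiff.2 h),
        indicator_of_mem (by exact ⟨hl, h⟩), hn']
    · rw [indicator_of_mem (by exact hl), indicator_of_notMem (by exact fun h' => h (hiff.1 h')),
        indicator_of_notMem (by exact fun h' => h h'.2), mul_zero]
  · rw [indicator_of_notMem (by exact hl), indicator_of_notMem (by exact fun h' => hl h'.1)]

variable {E : Type*} [NormedAddCommGroup E] [InnerProductSpace ℝ E] [FiniteDimensional ℝ E]
  [MeasurableSpace E] [BorelSpace E]

theorem lintegral_polar [Nontrivial E] (μ : Measure E) [μ.IsAddHaarMeasure] {f : E → ℝ≥0∞}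
    (hf : Measurable f) :
    ∫⁻ z, f z ∂μ = ∫⁻ ω : Metric.sphere (0 : E) 1, (∫⁻ l in Ioi (0 : ℝ),
      ENNReal.ofReal (l ^ (Module.finrank ℝ E - 1)) * f (l • (ω : E))) ∂μ.toSphere := by
  have h1 : ∫⁻ z, f z ∂μ = ∫⁻ z : ({(0)}ᶜ : Set E), f z ∂(μ.comap (↑)) := by
    rw [lintegral_subtype_comap (measurableSet_singleton _).compl, restrict_compl_singleton]
  have h2 := μ.measurePreserving_homeomorphUnitSphereProd.lintegral_comp
    (f := fun q => f ((q.2 : ℝ) • (q.1 : E))) (by fun_prop)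
  rw [h1]
  calc _ = ∫⁻ q, f ((q.2 : ℝ) • (q.1 : E))
          ∂(μ.toSphere.prod (Measure.volumeIoiPow (Module.finrank ℝ E - 1))) := by
        rw [← h2]
        refine lintegral_congr fun z => ?_
        have : ‖(z : E)‖ ≠ 0 := norm_ne_zero_iff.2 z.2
        simp [smul_smul, this]
    _ = _ := by
        rw [lintegral_prod _ (by fun_prop)]
        refine lintegral_congr fun ω => ?_
        rw [Measure.volumeIoiPow, lintegral_withDensity_eq_lintegral_mul _ (by fun_prop)
          (by fun_prop)]
        simp only [Pi.mul_apply]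
        rw [lintegral_subtype_comap (μ := volume) measurableSet_Ioi fun l : ℝ =>
          ENNReal.ofReal (l ^ (Module.finrank ℝ E - 1)) * f (l • (ω : E))]

/-- In polar coordinates centred at `x`, the Jacobian `l ^ (d - 1)` and the kernel `l ^ (-d)` leave
`l⁻¹`. By `lintegral_line` every pair of opposite rays contributes the same amount. -/
theorem setLIntegral_norm_lt_mul_kernel [Nontrivial E] (x : E) (hx : 0 < ‖x‖) {F : ℝ → ℝ≥0∞}
    (hF : Measurable F) :
    ∫⁻ y in {y : E | ‖x‖ < ‖y‖}, F (‖x‖ / ‖y‖) *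
        ENNReal.ofReal ((‖x - y‖ ^ Module.finrank ℝ E)⁻¹) =
      ∫⁻ r in Ioo 0 1, F r * ENNReal.ofReal
        ((volume : Measure E).toSphere.real univ * (1 - r ^ 2)⁻¹ * r⁻¹) := by
  set d := Module.finrank ℝ E with hd
  have hd0 : 0 < d := Module.finrank_pos
  have hS : MeasurableSet {y : E | ‖x‖ < ‖y‖} := measurableSet_lt measurable_const measurable_norm
  set I : E → ℝ≥0∞ := {y : E | ‖x‖ < ‖y‖}.indicator fun y => F (‖x‖ / ‖y‖) with hI
  have hIm : Measurable I := Measurable.indicator (by fun_prop) hS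
  set H : E → ℝ≥0∞ := fun z => I (x + z) * ENNReal.ofReal ((‖z‖ ^ d)⁻¹) with hH
  have hHm : Measurable H := by fun_prop
  have e1 : ∫⁻ y in {y : E | ‖x‖ < ‖y‖}, F (‖x‖ / ‖y‖) * ENNReal.ofReal ((‖x - y‖ ^ d)⁻¹) =
      ∫⁻ z, H z := by
    rw [← lintegral_indicator hS, ← lintegral_add_left_eq_self _ x]
    refine lintegral_congr fun z => ?_
    simp [hH, hI, indicator]
  -- Symmetrisation pairs the directions `ω` and `-ω`.
  have e2 : 2 * ∫⁻ z, H z = ∫⁻ z, (H z + H (-z)) := by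
    rw [lintegral_add_left hHm, lintegral_neg_eq_self, two_mul]
  have e3 : ∀ ω : Metric.sphere (0 : E) 1, ∫⁻ l in Ioi (0 : ℝ), ENNReal.ofReal (l ^ (d - 1)) *
      (H (l • (ω : E)) + H (-(l • (ω : E)))) =
      ∫⁻ r in Ioo (0 : ℝ) 1, 2 * (F r * ENNReal.ofReal ((1 - r ^ 2)⁻¹ * r⁻¹)) := fun ω => by
    have hω : ‖(ω : E)‖ = 1 := by simp
    rw [← lintegral_line (c := inner ℝ x (ω : E)) hx hF, ← setLIntegral_ray_norm hω (F := F),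
      ← inner_neg_right, ← setLIntegral_ray_norm (F := F) (by rw [norm_neg, hω]),
      ← lintegral_add_left (by fun_prop)]
    refine setLIntegral_congr_fun measurableSet_Ioi fun l hl => ?_
    have hl : 0 < l := hl
    have hld : ENNReal.ofReal (l ^ (d - 1)) * ENNReal.ofReal ((l ^ d)⁻¹) = ENNReal.ofReal l⁻¹ := by
      rw [← ENNReal.ofReal_mul (by positivity)]
      congr 1
      obtain ⟨n, hn⟩ : ∃ n, d = n + 1 := ⟨d - 1, by omega⟩
      rw [hn, add_tsub_cancel_right, pow_succ]
      field_simp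
    simp only [hH, norm_neg, norm_smul, hω, mul_one, Real.norm_of_nonneg hl.le, smul_neg]
    rw [← hld]
    ring
  have e4 : (volume : Measure E).toSphere univ =
      ENNReal.ofReal ((volume : Measure E).toSphere.real univ) :=
    (ENNReal.ofReal_toReal (measure_ne_top _ _)).symm
  have e5 : 2 * ∫⁻ z, H z = 2 * ∫⁻ r in Ioo (0 : ℝ) 1, F r * ENNReal.ofReal
      ((volume : Measure E).toSphere.real univ * (1 - r ^ 2)⁻¹ * r⁻¹) := by
    rw [e2, lintegral_polar volume (by fun_prop)]
    simp_rw [← hd, e3]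
    rw [lintegral_const, e4, lintegral_const_mul _ (by fun_prop), mul_assoc,
      ← lintegral_mul_const _ (by fun_prop)]
    congr 1
    refine lintegral_congr fun r => ?_
    rw [mul_assoc, mul_assoc, mul_comm (ENNReal.ofReal _) (ENNReal.ofReal _),
      ← ENNReal.ofReal_mul (by positivity)]
  rw [e1]
  exact (ENNReal.mul_right_inj two_ne_zero ENNReal.ofNat_ne_top).1 e5

/-- Inversion in the sphere of radius `‖y‖` exchanges inside and outside. The kernel and the
Jacobian together produce the factor `r ^ d`, so the exterior formula applies to `F r * r ^ d`. -/
theorem setLIntegral_lt_norm_mul_kernel [Nontrivial E] (y : E) (hy : 0 < ‖y‖) {F : ℝ → ℝ≥0∞}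
    (hF : Measurable F) :
    ∫⁻ x in {x : E | 0 < ‖x‖ ∧ ‖x‖ < ‖y‖}, F (‖x‖ / ‖y‖) *
        ENNReal.ofReal ((‖x - y‖ ^ Module.finrank ℝ E)⁻¹) =
      ∫⁻ r in Ioo 0 1, F r * ENNReal.ofReal
        ((volume : Measure E).toSphere.real univ * (1 - r ^ 2)⁻¹ *
          r ^ ((Module.finrank ℝ E : ℝ) - 1)) := by
  set d := Module.finrank ℝ E with hd
  have hd0 : 0 < d := Module.finrank_pos
  set R := ‖y‖ with hR
  have hS : MeasurableSet {x : E | 0 < ‖x‖ ∧ ‖x‖ < R} :=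
    (measurableSet_lt measurable_const measurable_norm).inter
      (measurableSet_lt measurable_norm measurable_const)
  have hS' : MeasurableSet {x : E | R < ‖x‖} := measurableSet_lt measurable_const measurable_norm
  have hinv : ∫⁻ x in {x : E | 0 < ‖x‖ ∧ ‖x‖ < R}, F (‖x‖ / R) *
        ENNReal.ofReal ((‖x - y‖ ^ d)⁻¹) =
      ∫⁻ x in {x : E | R < ‖x‖}, (F (R / ‖x‖) * ENNReal.ofReal ((R / ‖x‖) ^ d)) *
        ENNReal.ofReal ((‖y - x‖ ^ d)⁻¹) := by
    rw [← lintegral_indicator hS, ← lintegral_indicator hS',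
      lintegral_polar volume (Measurable.indicator (by fun_prop) hS),
      lintegral_polar volume (Measurable.indicator (by fun_prop) hS')]
    refine lintegral_congr fun ω => ?_
    have hω : ‖(ω : E)‖ = 1 := by simp
    rw [← hd]
    have e1 : ∫⁻ l in Ioi (0 : ℝ), ENNReal.ofReal (l ^ (d - 1)) *
        {x : E | 0 < ‖x‖ ∧ ‖x‖ < R}.indicator (fun x => F (‖x‖ / R) *
          ENNReal.ofReal ((‖x - y‖ ^ d)⁻¹)) (l • (ω : E)) =
        ∫⁻ l in Ioo 0 R, ENNReal.ofReal (l ^ (d - 1)) *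
          (F (l / R) * ENNReal.ofReal ((‖l • (ω : E) - y‖ ^ d)⁻¹)) := by
      rw [← lintegral_indicator measurableSet_Ioi, ← lintegral_indicator measurableSet_Ioo]
      refine lintegral_congr fun l => ?_
      by_cases h0 : 0 < l
      · by_cases h1 : l < R <;>
          simp [indicator, h0, h1, norm_smul, hω, abs_of_pos h0, h0.ne']
      · simp [indicator, h0]
    have e2 : ∫⁻ l in Ioi (0 : ℝ), ENNReal.ofReal (l ^ (d - 1)) *
        {x : E | R < ‖x‖}.indicator (fun x => (F (R / ‖x‖) * ENNReal.ofReal ((R / ‖x‖) ^ d)) *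
          ENNReal.ofReal ((‖y - x‖ ^ d)⁻¹)) (l • (ω : E)) =
        ∫⁻ l in Ioi R, ENNReal.ofReal (l ^ (d - 1)) * ((F (R / l) * ENNReal.ofReal ((R / l) ^ d)) *
          ENNReal.ofReal ((‖y - l • (ω : E)‖ ^ d)⁻¹)) := by
      rw [← lintegral_indicator measurableSet_Ioi, ← lintegral_indicator measurableSet_Ioi]
      refine lintegral_congr fun l => ?_
      by_cases h0 : 0 < l
      · by_cases h1 : R < l <;>
          simp [indicator, h0, h1, norm_smul, hω, abs_of_pos h0]
      · simp [indicator, h0, show ¬ R < l from fun h => h0 (hy.trans h)]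
    rw [e1, e2, setLIntegral_Ioo_eq_mul hy, setLIntegral_Ioi_eq_inv hy]
    refine setLIntegral_congr_fun measurableSet_Ioo fun r hr => ?_
    have hr0 := hr.1
    -- The distance formula for inversion; it uses that `y` lies on the sphere of radius `R`.
    have hn : ‖(R * r) • (ω : E) - y‖ = r * ‖y - (R / r) • (ω : E)‖ := by
      rw [← sq_eq_sq₀ (norm_nonneg _) (by positivity), mul_pow, norm_sub_sq_real,
        norm_sub_sq_real, norm_smul, norm_smul, inner_smul_left, inner_smul_right, hω,
        Real.norm_of_nonneg (by positivity), Real.norm_of_nonneg (by positivity), ← hR,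
        real_inner_comm y]
      simp only [conj_trivial]
      field_simp
    have q1 : R * r / R = r := by field_simp
    have q2 : R / (R / r) = r := by field_simp
    rw [hn, q1, q2]
    have q3 : R * ((R * r) ^ (d - 1) * ((r * ‖y - (R / r) • (ω : E)‖) ^ d)⁻¹) =
        R / r ^ 2 * ((R / r) ^ (d - 1) * (r ^ d * (‖y - (R / r) • (ω : E)‖ ^ d)⁻¹)) := by
      obtain ⟨n, hn⟩ : ∃ n, d = n + 1 := ⟨d - 1, by omega⟩
      rw [hn, add_tsub_cancel_right, mul_pow, mul_pow, mul_inv, div_pow]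
      have : (r ^ (n + 1))⁻¹ = r ^ (n + 1) / (r ^ n * r ^ 2 * r ^ n) := by
        field_simp; ring
      rw [this]
      field_simp
    have q4 := congr_arg ENNReal.ofReal q3
    rw [ENNReal.ofReal_mul hy.le, ENNReal.ofReal_mul (by positivity),
      ENNReal.ofReal_mul (by positivity), ENNReal.ofReal_mul (by positivity),
      ENNReal.ofReal_mul (by positivity)] at q4
    calc _ = F r * (ENNReal.ofReal R * (ENNReal.ofReal ((R * r) ^ (d - 1)) *
          ENNReal.ofReal ((r * ‖y - (R / r) • (ω : E)‖) ^ d)⁻¹)) := by ring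
      _ = _ := by rw [q4]; ring
  rw [hinv]
  have h := setLIntegral_norm_lt_mul_kernel y hy (F := fun r => F r * ENNReal.ofReal (r ^ d))
    (by fun_prop)
  rw [h]
  refine setLIntegral_congr_fun measurableSet_Ioo fun r hr => ?_
  have hr0 := hr.1
  rw [mul_assoc, ← ENNReal.ofReal_mul (by positivity)]
  congr 2
  rw [Real.rpow_sub_one hr0.ne', Real.rpow_natCast]
  ring

end Polar

/-! ### Closed form of `hardyPhi` at `s = 0`. -/

theorem lintegral_one_sub_sq_rpow {a : ℝ} (ha : 0 < a) :
    ∫⁻ c in Ioo (-1 : ℝ) 1, ENNReal.ofReal ((1 - c ^ 2) ^ (a - 1)) =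
      ENNReal.ofReal (√Real.pi * Real.Gamma a / Real.Gamma (a + 1 / 2)) := by
  have himg : (fun x : ℝ => 2 * x - 1) '' Ioo 0 1 = Ioo (-1 : ℝ) 1 := by
    ext s
    simp only [mem_image, mem_Ioo]
    constructor
    · rintro ⟨r, ⟨h0, h1⟩, rfl⟩
      constructor <;> linarith
    · intro h
      exact ⟨(s + 1) / 2, ⟨by linarith [h.1], by linarith [h.2]⟩, by ring⟩
  have hb := ProbabilityTheory.beta_pos ha ha
  have hbeta : ∫⁻ x in Ioo (0 : ℝ) 1, ENNReal.ofReal (x ^ (a - 1) * (1 - x) ^ (a - 1)) =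
      ENNReal.ofReal (ProbabilityTheory.beta a a) := by
    have h := ProbabilityTheory.lintegral_betaPDF_eq_one ha ha
    rw [ProbabilityTheory.lintegral_betaPDF] at h
    simp_rw [mul_assoc] at h
    simp_rw [ENNReal.ofReal_mul (one_div_pos.2 hb).le] at h
    rw [lintegral_const_mul _ (by fun_prop)] at h
    calc _ = ENNReal.ofReal (ProbabilityTheory.beta a a) *
          (ENNReal.ofReal (1 / ProbabilityTheory.beta a a) *
            ∫⁻ x in Ioo (0 : ℝ) 1, ENNReal.ofReal (x ^ (a - 1) * (1 - x) ^ (a - 1))) := by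
          rw [← mul_assoc, ← ENNReal.ofReal_mul hb.le, mul_one_div_cancel hb.ne',
            ENNReal.ofReal_one, one_mul]
      _ = _ := by rw [h, mul_one]
  rw [← himg, lintegral_image_eq_lintegral_abs_deriv_mul measurableSet_Ioo (f' := fun _ => 2)]
  · have e : ∀ x ∈ Ioo (0 : ℝ) 1, ENNReal.ofReal |2| *
        ENNReal.ofReal ((1 - (2 * x - 1) ^ 2) ^ (a - 1)) =
        ENNReal.ofReal (2 * 4 ^ (a - 1)) *
          ENNReal.ofReal (x ^ (a - 1) * (1 - x) ^ (a - 1)) := fun x hx => by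
      have h1 : 0 ≤ 1 - x := by linarith [hx.2]
      rw [← ENNReal.ofReal_mul (by positivity), ← ENNReal.ofReal_mul (by positivity), abs_two,
        show 1 - (2 * x - 1) ^ 2 = 4 * (x * (1 - x)) by ring,
        Real.mul_rpow (by norm_num) (mul_nonneg hx.1.le h1), Real.mul_rpow hx.1.le h1, mul_assoc]
    rw [setLIntegral_congr_fun measurableSet_Ioo e, lintegral_const_mul _ (by fun_prop), hbeta,
      ← ENNReal.ofReal_mul (by positivity)]
    congr 1
    -- Legendre duplication converts the `Γ(2a)` of the Beta function into `Γ(a + 1/2)`.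
    have hd := Real.Gamma_mul_Gamma_add_half a
    have g1 := Real.Gamma_pos_of_pos ha
    have g2 : 0 < Real.Gamma (a + 1 / 2) := Real.Gamma_pos_of_pos (by linarith)
    have g3 : 0 < Real.Gamma (2 * a) := Real.Gamma_pos_of_pos (by linarith)
    have h4 : (2 : ℝ) * 4 ^ (a - 1) * 2 ^ (1 - 2 * a) = 1 := by
      rw [show (4 : ℝ) = 2 ^ (2 : ℝ) by norm_num, ← Real.rpow_mul (by norm_num), mul_assoc,
        ← Real.rpow_add (by norm_num), show 2 * (a - 1) + (1 - 2 * a) = -1 by ring]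
      norm_num [Real.rpow_neg_one]
    rw [ProbabilityTheory.beta, ← two_mul, eq_div_iff g2.ne']
    calc _ = 2 * 4 ^ (a - 1) * (Real.Gamma a * Real.Gamma (a + 1 / 2)) *
          (Real.Gamma a / Real.Gamma (2 * a)) := by ring
      _ = (2 * 4 ^ (a - 1) * 2 ^ (1 - 2 * a)) * (√Real.pi * Real.Gamma a) := by
        rw [hd]; field_simp
      _ = _ := by rw [h4, one_mul]
  · intro x _
    simpa using (((hasDerivAt_id x).const_mul 2).sub_const 1).hasDerivWithinAt (s := Ioo 0 1)
  · intro x _ y _ h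
    simpa using h

/-- Algebraic relations between the parameters of the chord of the unit circle through `(r, 0)`
with direction of cosine `c`. -/
theorem chord_relations {r c : ℝ} (hr : r ∈ Ioo (0 : ℝ) 1) :
    0 < √(1 - r ^ 2 + r ^ 2 * c ^ 2) - r * c ∧ 0 < √(1 - r ^ 2 + r ^ 2 * c ^ 2) ∧
      √(1 - r ^ 2 + r ^ 2 * c ^ 2) ^ 2 = 1 - r ^ 2 + r ^ 2 * c ^ 2 := by
  have h1 : 0 < 1 - r ^ 2 := by nlinarith [hr.1, hr.2]
  have h2 : |r * c| < √(1 - r ^ 2 + r ^ 2 * c ^ 2) :=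
    Real.lt_sqrt_of_sq_lt (by rw [sq_abs, mul_pow]; linarith)
  exact ⟨by linarith [(abs_lt.1 h2).2], (abs_nonneg _).trans_lt h2,
    Real.sq_sqrt (by nlinarith [sq_nonneg (r * c)])⟩

theorem chord_image {r : ℝ} (hr : r ∈ Ioo (0 : ℝ) 1) :
    (fun c : ℝ => r + c * (√(1 - r ^ 2 + r ^ 2 * c ^ 2) - r * c)) '' Ioo (-1) 1 = Ioo (-1) 1 := by
  ext t
  simp only [mem_image]
  constructor
  · rintro ⟨c, hc, rfl⟩
    obtain ⟨h1, -, h2⟩ := chord_relations (c := c) hr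
    set q := √(1 - r ^ 2 + r ^ 2 * c ^ 2)
    have e : 1 - (r + c * (q - r * c)) ^ 2 = (q - r * c) ^ 2 * (1 - c ^ 2) := by
      linear_combination (-1) * h2
    have hc2 : 0 < 1 - c ^ 2 := by nlinarith [hc.1, hc.2]
    have : (r + c * (q - r * c)) ^ 2 < 1 := by
      have : 0 < (q - r * c) ^ 2 * (1 - c ^ 2) := by positivity
      linarith
    exact abs_lt.1 ((sq_lt_one_iff_abs_lt_one _).1 this)
  · intro ht
    have hr1 := hr.1
    have hpos : 0 < 1 - 2 * r * t + r ^ 2 := by nlinarith [ht.1, ht.2, hr.1, hr.2, sq_nonneg (1 - r)]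
    -- `l` is the distance from `(r, 0)` to the point of the unit circle with abscissa `t`; the
    -- direction cosine of that segment is `(t - r) / l`.
    set l := √(1 - 2 * r * t + r ^ 2) with hl
    have hl0 : 0 < l := Real.sqrt_pos.2 hpos
    have hl2 : l ^ 2 = 1 - 2 * r * t + r ^ 2 := Real.sq_sqrt hpos.le
    have hq : √(1 - r ^ 2 + r ^ 2 * ((t - r) / l) ^ 2) = l + r * ((t - r) / l) := by
      have h1 : l * ((t - r) / l) = t - r := by field_simp
      have h2 : l + r * ((t - r) / l) = (l ^ 2 + r * (t - r)) / l := by field_simp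
      have h3 : 0 < l + r * ((t - r) / l) := by
        rw [h2, hl2]
        exact div_pos (by nlinarith [ht.2, hr.1, hr.2]) hl0
      rw [show 1 - r ^ 2 + r ^ 2 * ((t - r) / l) ^ 2 = (l + r * ((t - r) / l)) ^ 2 by
        linear_combination (-1) * hl2 - 2 * r * h1, Real.sqrt_sq h3.le]
    refine ⟨(t - r) / l, ?_, ?_⟩
    · refine abs_lt.1 ?_
      rw [abs_div, abs_of_pos hl0, div_lt_one hl0]
      refine abs_lt_of_sq_lt_sq ?_ hl0.le
      rw [hl2]
      nlinarith [ht.1, ht.2]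
    · rw [hq]; field_simp; ring

theorem hasDerivAt_chord {r : ℝ} (hr : r ∈ Ioo (0 : ℝ) 1) (c : ℝ) :
    HasDerivAt (fun c : ℝ => r + c * (√(1 - r ^ 2 + r ^ 2 * c ^ 2) - r * c))
      ((√(1 - r ^ 2 + r ^ 2 * c ^ 2) - r * c) ^ 2 / √(1 - r ^ 2 + r ^ 2 * c ^ 2)) c := by
  obtain ⟨h1, h0, h2⟩ := chord_relations (c := c) hr
  have hne : 1 - r ^ 2 + r ^ 2 * c ^ 2 ≠ 0 := by rw [← h2]; positivity
  have hd := ((((((hasDerivAt_pow 2 c).const_mul (r ^ 2)).const_add (1 - r ^ 2)).sqrt hne).sub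
    ((hasDerivAt_id c).const_mul r)).fun_mul (hasDerivAt_id c)).const_add r
  convert! hd using 1
  · ext x; simp [mul_comm]
  · simp
    field_simp
    ring

/-- The abscissa `t` on the unit circle is replaced by the direction cosine `c` seen from `(r, 0)`.
With `l` the distance to the circle, `1 - t ^ 2 = l ^ 2 * (1 - c ^ 2)` and `1 - 2 * t * r + r ^ 2 =
l ^ 2`, leaving `(1 - c ^ 2) ^ (a - 1) / (q * l)`. Averaging over `c` and `-c` gives the constant
factor `(1 - r ^ 2)⁻¹`. -/
theorem lintegral_zonal_poisson {a r : ℝ} (hr : r ∈ Ioo (0 : ℝ) 1) :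
    ∫⁻ t in Ioo (-1 : ℝ) 1,
        ENNReal.ofReal ((1 - t ^ 2) ^ (a - 1) / (1 - 2 * t * r + r ^ 2) ^ (a + 1 / 2)) =
      ENNReal.ofReal (1 - r ^ 2)⁻¹ *
        ∫⁻ c in Ioo (-1 : ℝ) 1, ENNReal.ofReal ((1 - c ^ 2) ^ (a - 1)) := by
  have hr2 : 0 < 1 - r ^ 2 := by nlinarith [hr.1, hr.2]
  set q : ℝ → ℝ := fun c => √(1 - r ^ 2 + r ^ 2 * c ^ 2) with hq
  set g : ℝ → ℝ≥0∞ := fun c =>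
    ENNReal.ofReal ((1 - c ^ 2) ^ (a - 1) / (q c * (q c - r * c))) with hg
  have hgm : Measurable g := by fun_prop
  have h1 : ∫⁻ t in Ioo (-1 : ℝ) 1,
      ENNReal.ofReal ((1 - t ^ 2) ^ (a - 1) / (1 - 2 * t * r + r ^ 2) ^ (a + 1 / 2)) =
      ∫⁻ c in Ioo (-1 : ℝ) 1, g c := by
    rw [← chord_image hr, lintegral_image_eq_lintegral_abs_deriv_mul measurableSet_Ioo
      (fun c _ => (hasDerivAt_chord hr c).hasDerivWithinAt), chord_image hr]
    · refine setLIntegral_congr_fun measurableSet_Ioo fun c hc => ?_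
      obtain ⟨h1, h0, h2⟩ := chord_relations (c := c) hr
      have hc2 : 0 < 1 - c ^ 2 := by nlinarith [hc.1, hc.2]
      simp only [hg, hq]
      set s := √(1 - r ^ 2 + r ^ 2 * c ^ 2)
      have e1 : 1 - (r + c * (s - r * c)) ^ 2 = (s - r * c) ^ 2 * (1 - c ^ 2) := by
        linear_combination (-1) * h2
      have e2 : 1 - 2 * (r + c * (s - r * c)) * r + r ^ 2 = (s - r * c) ^ 2 := by
        linear_combination (-1) * h2
      rw [abs_of_pos (by positivity), ← ENNReal.ofReal_mul (by positivity), e1, e2,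
        Real.mul_rpow (by positivity) hc2.le]
      congr 1
      have e3 : ((s - r * c) ^ 2) ^ (a + 1 / 2) =
          ((s - r * c) ^ 2) ^ (a - 1) * (s - r * c) ^ 3 := by
        rw [show a + 1 / 2 = (a - 1) + 3 / 2 by ring, Real.rpow_add (by positivity)]
        congr 1
        rw [← Real.rpow_natCast (s - r * c) 2, ← Real.rpow_mul h1.le,
          ← Real.rpow_natCast (s - r * c) 3]
        norm_num
      rw [e3]
      have : 0 < ((s - r * c) ^ 2) ^ (a - 1) := Real.rpow_pos_of_pos (by positivity) _
      field_simp
    · intro c hc c' hc' h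
      obtain ⟨h1, h0, h2⟩ := chord_relations (c := c) hr
      obtain ⟨h1', h0', h2'⟩ := chord_relations (c := c') hr
      simp only at h
      set s := √(1 - r ^ 2 + r ^ 2 * c ^ 2)
      set s' := √(1 - r ^ 2 + r ^ 2 * c' ^ 2)
      have e : (s - r * c) ^ 2 = (s' - r * c') ^ 2 := by
        linear_combination h2 - h2' - 2 * r * h
      have e' : s - r * c = s' - r * c' := (sq_eq_sq₀ h1.le h1'.le).1 e
      rw [← e'] at h
      exact mul_right_cancel₀ h1.ne' (add_left_cancel h)
  have h2 : ∫⁻ c in Ioo (-1 : ℝ) 1, g (-c) = ∫⁻ c in Ioo (-1 : ℝ) 1, g c := by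
    rw [← (Measure.measurePreserving_neg (volume : Measure ℝ)).setLIntegral_comp_preimage
      measurableSet_Ioo hgm]
    simp
  have h3 : 2 * ∫⁻ c in Ioo (-1 : ℝ) 1, g c = 2 * (ENNReal.ofReal (1 - r ^ 2)⁻¹ *
      ∫⁻ c in Ioo (-1 : ℝ) 1, ENNReal.ofReal ((1 - c ^ 2) ^ (a - 1))) := by
    rw [two_mul]
    nth_rewrite 2 [← h2]
    rw [← lintegral_add_left hgm, ← mul_assoc, ← lintegral_const_mul _ (by fun_prop)]
    refine setLIntegral_congr_fun measurableSet_Ioo fun c hc => ?_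
    obtain ⟨h1, h0, h2⟩ := chord_relations (c := c) hr
    obtain ⟨h1', -, -⟩ := chord_relations (c := -c) hr
    have hc2 : 0 < 1 - c ^ 2 := by nlinarith [hc.1, hc.2]
    simp only [hg, hq, neg_sq] at h1' ⊢
    set s := √(1 - r ^ 2 + r ^ 2 * c ^ 2)
    rw [← ENNReal.ofReal_add (by positivity) (by positivity), ← ENNReal.ofReal_ofNat,
      ← ENNReal.ofReal_mul (by positivity), ← ENNReal.ofReal_mul (by positivity)]
    congr 1
    -- Power of a point: the two segments of the chord through `(r, 0)` have product `1 - r ^ 2`,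
    -- and their sum is `2 * s`.
    have e : (s - r * c) * (s - r * -c) = 1 - r ^ 2 := by linear_combination h2
    have hs : (s - r * c) + (s - r * -c) = 2 * s := by ring
    rw [← e]
    generalize s - r * c = u at h1 hs
    generalize s - r * -c = v at h1' hs
    field_simp
    linear_combination hs
  rw [h1]
  exact (ENNReal.mul_right_inj two_ne_zero ENNReal.ofNat_ne_top).1 h3

theorem unitSphereArea_eq {n : ℕ} (hn : 0 < n) :
    unitSphereArea n = 2 * Real.pi ^ ((n : ℝ) / 2) / Real.Gamma ((n : ℝ) / 2) := by
  have : Nonempty (Fin n) := ⟨⟨0, hn⟩⟩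
  have hn' : (0 : ℝ) < n := by exact_mod_cast hn
  have g := Real.Gamma_pos_of_pos (half_pos hn')
  rw [unitSphereArea, Measure.toSphere_real_apply_univ, Measure.real, EuclideanSpace.volume_ball]
  simp only [finrank_euclideanSpace, Fintype.card_fin, ENNReal.ofReal_one, one_pow, one_mul]
  rw [ENNReal.toReal_ofReal (div_nonneg (by positivity)
    (Real.Gamma_pos_of_pos (by positivity)).le), Real.Gamma_add_one (by positivity),
    Real.sqrt_eq_rpow, ← Real.rpow_natCast, ← Real.rpow_mul Real.pi_pos.le,
    show (1 / 2 : ℝ) * n = n / 2 by ring]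
  field_simp

theorem hardyPhi_zero_eq {d : ℕ} (hd : 0 < d) (p : ℝ) {r : ℝ} (hr : r ∈ Ioo (0 : ℝ) 1) :
    hardyPhi d 0 p r = unitSphereArea d * (1 - r ^ 2)⁻¹ := by
  have hr2 : 0 < 1 - r ^ 2 := by nlinarith [hr.1, hr.2]
  unfold hardyPhi
  split_ifs with h
  · set a : ℝ := ((d : ℝ) - 1) / 2 with ha
    have hd2 : (2 : ℝ) ≤ d := by exact_mod_cast h
    have ha0 : 0 < a := by rw [ha]; linarith
    have e1 : ((d : ℝ) - 3) / 2 = a - 1 := by rw [ha]; ring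
    have e2 : ((d : ℝ) + 0 * p) / 2 = a + 1 / 2 := by rw [ha]; ring
    have hnn : ∀ t ∈ Ioo (-1 : ℝ) 1,
        0 ≤ (1 - t ^ 2) ^ (a - 1) / (1 - 2 * t * r + r ^ 2) ^ (a + 1 / 2) := fun t ht => by
      refine div_nonneg (Real.rpow_nonneg ?_ _) (Real.rpow_nonneg ?_ _)
      · nlinarith [ht.1, ht.2]
      · nlinarith [ht.1, ht.2, hr.1, hr.2, sq_nonneg (1 - r)]
    have g1 := Real.Gamma_pos_of_pos ha0
    have g2 : 0 < Real.Gamma (a + 1 / 2) := Real.Gamma_pos_of_pos (by linarith)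
    rw [e1, e2, intervalIntegral.integral_of_le (by norm_num), integral_Ioc_eq_integral_Ioo,
      integral_eq_lintegral_of_nonneg_ae ((ae_restrict_iff' measurableSet_Ioo).2 (.of_forall hnn))
      (Measurable.aestronglyMeasurable (by fun_prop)), lintegral_zonal_poisson hr, lintegral_one_sub_sq_rpow ha0,
      ← ENNReal.ofReal_mul (by positivity), ENNReal.toReal_ofReal (by positivity),
      unitSphereArea_eq hd, unitSphereArea_eq (by omega), Nat.cast_sub (by omega), Nat.cast_one,
      ← ha, show (d : ℝ) / 2 = a + 1 / 2 by rw [ha]; ring, Real.rpow_add Real.pi_pos,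
      Real.sqrt_eq_rpow]
    field_simp
  · obtain rfl : d = 1 := by omega
    have h1 : 0 < 1 - r := by linarith [hr.2]
    have h2 : 0 < 1 + r := by linarith [hr.1]
    rw [unitSphereArea_eq one_pos, Nat.cast_one, Real.Gamma_one_half_eq, ← Real.sqrt_eq_rpow,
      zero_mul, sub_zero, Real.rpow_neg_one, Real.rpow_neg_one,
      show 1 - r ^ 2 = (1 - r) * (1 + r) by ring]
    have : 0 < √Real.pi := Real.sqrt_pos.2 Real.pi_pos
    field_simp
    ring

/-! ### The kernel integrated over hyperplanes. -/

theorem lintegral_rpow_mul_exp_neg_mul {s q : ℝ} (hs : 0 < s) (hq : 0 < q) :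
    ∫⁻ τ in Ioi (0 : ℝ), ENNReal.ofReal (τ ^ (s - 1) * Real.exp (-(q * τ))) =
      ENNReal.ofReal ((1 / q) ^ s * Real.Gamma s) := by
  have h := Real.integral_rpow_mul_exp_neg_mul_Ioi hs hq
  have hpos : 0 < (1 / q) ^ s * Real.Gamma s := mul_pos (by positivity) (Real.Gamma_pos_of_pos hs)
  rw [← h, ofReal_integral_eq_lintegral_ofReal
    (Integrable.of_integral_ne_zero (by rw [h]; exact hpos.ne'))]
  refine (ae_restrict_iff' measurableSet_Ioi).2 (.of_forall fun τ hτ => ?_)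
  have : 0 < τ := hτ
  positivity

theorem lintegral_exp_neg_mul_sq_norm {V : Type*} [NormedAddCommGroup V] [InnerProductSpace ℝ V]
    [FiniteDimensional ℝ V] [MeasurableSpace V] [BorelSpace V] {b : ℝ} (hb : 0 < b) :
    ∫⁻ v : V, ENNReal.ofReal (Real.exp (-b * ‖v‖ ^ 2)) =
      ENNReal.ofReal ((Real.pi / b) ^ (Module.finrank ℝ V / 2 : ℝ)) := by
  have h := GaussianFourier.integral_rexp_neg_mul_sq_norm (V := V) hb
  have hpos : 0 < (Real.pi / b) ^ (Module.finrank ℝ V / 2 : ℝ) := by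
    have := Real.pi_pos
    positivity
  rw [← h, ofReal_integral_eq_lintegral_ofReal
    (Integrable.of_integral_ne_zero (by rw [h]; exact hpos.ne'))]
  exact .of_forall fun v => (Real.exp_pos _).le

/-- The constant in the integral of the Poisson-type kernel of a half-space over hyperplanes. -/
noncomputable def halfSpaceConst (n : ℕ) : ℝ :=
  Real.pi ^ ((n : ℝ) / 2) * Real.Gamma (1 / 2) / Real.Gamma (((n : ℝ) + 1) / 2)

theorem halfSpaceConst_pos (n : ℕ) : 0 < halfSpaceConst n := by
  have := Real.pi_pos
  have := Real.Gamma_pos_of_pos (s := 1 / 2) (by norm_num)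
  have := Real.Gamma_pos_of_pos (s := ((n : ℝ) + 1) / 2) (by positivity)
  unfold halfSpaceConst
  positivity

/-- Subordination: the power is a Gamma integral of Gaussians in `z`. Integrating out `z` gives `(π
/ τ) ^ (n / 2)` and leaves a Gamma integral of exponent `1 / 2`. -/
theorem lintegral_sq_add_sq_norm_rpow {V : Type*} [NormedAddCommGroup V] [InnerProductSpace ℝ V]
    [FiniteDimensional ℝ V] [MeasurableSpace V] [BorelSpace V] {a : ℝ} (ha : 0 < a) :
    ∫⁻ z : V, ENNReal.ofReal (((a ^ 2 + ‖z‖ ^ 2) ^ (((Module.finrank ℝ V : ℝ) + 1) / 2))⁻¹) =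
      ENNReal.ofReal (halfSpaceConst (Module.finrank ℝ V) / a) := by
  set n := Module.finrank ℝ V with hn
  set s : ℝ := ((n : ℝ) + 1) / 2 with hs
  have hs0 : 0 < s := by positivity
  have hπ := Real.pi_pos
  have hΓ := Real.Gamma_pos_of_pos hs0
  have hΓ2 := Real.Gamma_pos_of_pos (s := 1 / 2) (by norm_num)
  have key : ENNReal.ofReal (Real.Gamma s) * ∫⁻ z : V,
      ENNReal.ofReal (((a ^ 2 + ‖z‖ ^ 2) ^ s)⁻¹) =
      ENNReal.ofReal (Real.Gamma s) * ENNReal.ofReal (halfSpaceConst n / a) := by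
    calc _ = ∫⁻ z : V, ∫⁻ τ in Ioi (0 : ℝ),
          ENNReal.ofReal (τ ^ (s - 1) * Real.exp (-((a ^ 2 + ‖z‖ ^ 2) * τ))) := by
          rw [← lintegral_const_mul _ (by fun_prop)]
          refine lintegral_congr fun z => ?_
          rw [lintegral_rpow_mul_exp_neg_mul hs0 (by positivity),
            ← ENNReal.ofReal_mul hΓ.le, one_div, Real.inv_rpow (by positivity), mul_comm]
      _ = ∫⁻ τ in Ioi (0 : ℝ), ∫⁻ z : V,
          ENNReal.ofReal (τ ^ (s - 1) * Real.exp (-((a ^ 2 + ‖z‖ ^ 2) * τ))) :=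
          lintegral_lintegral_swap (by unfold Function.uncurry; fun_prop)
      _ = ∫⁻ τ in Ioi (0 : ℝ), ENNReal.ofReal (Real.pi ^ ((n : ℝ) / 2)) *
          ENNReal.ofReal (τ ^ ((1 : ℝ) / 2 - 1) * Real.exp (-(a ^ 2 * τ))) := by
          refine setLIntegral_congr_fun measurableSet_Ioi fun τ hτ => ?_
          have hτ : 0 < τ := hτ
          have e : ∀ z : V, ENNReal.ofReal (τ ^ (s - 1) * Real.exp (-((a ^ 2 + ‖z‖ ^ 2) * τ))) =
              ENNReal.ofReal (τ ^ (s - 1) * Real.exp (-(a ^ 2 * τ))) *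
                ENNReal.ofReal (Real.exp (-τ * ‖z‖ ^ 2)) := fun z => by
            rw [← ENNReal.ofReal_mul (by positivity), mul_assoc, ← Real.exp_add]
            congr 3
            ring
          simp_rw [e]
          rw [lintegral_const_mul _ (by fun_prop), lintegral_exp_neg_mul_sq_norm hτ, ← hn,
            ← ENNReal.ofReal_mul (by positivity), ← ENNReal.ofReal_mul (by positivity)]
          congr 1
          rw [Real.div_rpow hπ.le hτ.le, show s - 1 = ((1 : ℝ) / 2 - 1) + n / 2 by rw [hs]; ring,
            Real.rpow_add hτ]
          field_simp
      _ = ENNReal.ofReal (Real.Gamma s) * ENNReal.ofReal (halfSpaceConst n / a) := by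
          rw [lintegral_const_mul _ (by fun_prop), lintegral_rpow_mul_exp_neg_mul (by norm_num)
            (by positivity), ← ENNReal.ofReal_mul (by positivity), ← ENNReal.ofReal_mul hΓ.le]
          congr 1
          rw [halfSpaceConst, ← hs, ← Real.sqrt_eq_rpow, one_div (a ^ 2), Real.sqrt_inv,
            Real.sqrt_sq ha.le]
          field_simp
  exact (ENNReal.mul_right_inj (by simpa using hΓ) ENNReal.ofReal_ne_top).1 key

theorem lintegral_last_coord {n : ℕ} (x : EuclideanSpace ℝ (Fin (n + 1))) {G : ℝ → ℝ → ℝ≥0∞}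
    (hG : Measurable (Function.uncurry G)) :
    ∫⁻ y : EuclideanSpace ℝ (Fin (n + 1)), G (y (Fin.last n)) (‖x - y‖ ^ 2) =
      ∫⁻ t : ℝ, ∫⁻ z : EuclideanSpace ℝ (Fin n),
        G t ((x (Fin.last n) - t) ^ 2 + ‖z‖ ^ 2) := by
  have hG' : Measurable fun q : ℝ × ℝ => G q.1 q.2 := hG
  have hGc : ∀ {Y : Type} [MeasurableSpace Y] {f g : Y → ℝ}, Measurable f → Measurable g →
      Measurable fun y => G (f y) (g y) := fun hf hg => hG'.comp (hf.prodMk hg)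
  have hm : Measurable fun y : EuclideanSpace ℝ (Fin (n + 1)) =>
      G (y (Fin.last n)) (‖x - y‖ ^ 2) := hGc (by fun_prop) (by fun_prop)
  have hm1 : Measurable fun v : Fin (n + 1) → ℝ =>
      G (v (Fin.last n)) (‖x - WithLp.toLp 2 v‖ ^ 2) := hGc (by fun_prop) (by fun_prop)
  rw [← (PiLp.volume_preserving_toLp (Fin (n + 1))).lintegral_comp hm,
    ← (volume_preserving_piFinSuccAbove (fun _ => ℝ) (Fin.last n)).symm.lintegral_comp hm1,
    Measure.volume_eq_prod, lintegral_prod]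
  · refine lintegral_congr fun t => ?_
    have hm2 : Measurable fun z : EuclideanSpace ℝ (Fin n) =>
      G t ((x (Fin.last n) - t) ^ 2 + ‖z‖ ^ 2) := hGc (by fun_prop) (by fun_prop)
    rw [← (PiLp.volume_preserving_toLp (Fin n)).lintegral_comp hm2,
      ← lintegral_sub_left_eq_self _ fun i : Fin n => x i.castSucc]
    refine lintegral_congr fun w => ?_
    simp [EuclideanSpace.norm_sq_eq, Fin.sum_univ_castSucc, MeasurableEquiv.piFinSuccAbove,
      add_comm]
  · refine Measurable.aemeasurable ?_
    exact hm1.comp (MeasurableEquiv.measurable _)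

theorem lintegral_last_coord_mul_kernel {n : ℕ} (x : EuclideanSpace ℝ (Fin (n + 1)))
    {F : ℝ → ℝ≥0∞} (hF : Measurable F) :
    ∫⁻ y : EuclideanSpace ℝ (Fin (n + 1)),
        F (y (Fin.last n)) * ENNReal.ofReal ((‖x - y‖ ^ (n + 1))⁻¹) =
      ∫⁻ t : ℝ, F t * ENNReal.ofReal (halfSpaceConst n / |x (Fin.last n) - t|) := by
  have e : ∀ y : EuclideanSpace ℝ (Fin (n + 1)), ‖x - y‖ ^ (n + 1) =
      (‖x - y‖ ^ 2) ^ (((n : ℝ) + 1) / 2) := fun y => by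
    rw [← Real.rpow_natCast, ← Real.rpow_natCast, ← Real.rpow_mul (norm_nonneg _)]
    congr 1
    push_cast
    ring
  simp_rw [e]
  rw [lintegral_last_coord x (G := fun t w => F t * ENNReal.ofReal ((w ^ (((n : ℝ) + 1) / 2))⁻¹))
    (by unfold Function.uncurry; fun_prop)]
  -- The hyperplane through `x` itself, at distance zero, is negligible.
  have hne : ∀ᵐ t : ℝ, t ≠ x (Fin.last n) := by
    simp [ae_iff]
  refine lintegral_congr_ae (hne.mono fun t ht => ?_)
  have h := lintegral_sq_add_sq_norm_rpow (V := EuclideanSpace ℝ (Fin n))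
    (abs_pos.2 (sub_ne_zero.2 ht.symm))
  simp only [finrank_euclideanSpace, Fintype.card_fin, sq_abs] at h
  dsimp only
  rw [lintegral_const_mul _ (by fun_prop), h]

theorem setLIntegral_lastCoord_lt_mul_kernel {n : ℕ} (x : EuclideanSpace ℝ (Fin (n + 1)))
    (hx : 0 < x (Fin.last n)) {F : ℝ → ℝ≥0∞} (hF : Measurable F) :
    ∫⁻ y in {y : EuclideanSpace ℝ (Fin (n + 1)) | x (Fin.last n) < y (Fin.last n)},
        F (x (Fin.last n) / y (Fin.last n)) * ENNReal.ofReal ((‖x - y‖ ^ (n + 1))⁻¹) =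
      ∫⁻ r in Ioo 0 1, F r * ENNReal.ofReal (halfSpaceConst n * (1 - r)⁻¹ * r⁻¹) := by
  set a := x (Fin.last n)
  have hc := halfSpaceConst_pos n
  have h := lintegral_last_coord_mul_kernel x (F := (Ioi a).indicator fun t => F (a / t))
    (Measurable.indicator (by fun_prop) measurableSet_Ioi)
  calc _ = ∫⁻ y : EuclideanSpace ℝ (Fin (n + 1)), (Ioi a).indicator (fun t => F (a / t))
        (y (Fin.last n)) * ENNReal.ofReal ((‖x - y‖ ^ (n + 1))⁻¹) := by
        rw [← lintegral_indicator (measurableSet_lt measurable_const (by fun_prop))]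
        refine lintegral_congr fun y => ?_
        simp [indicator]
    _ = ∫⁻ t in Ioi a, F (a / t) * ENNReal.ofReal (halfSpaceConst n / |a - t|) := by
        rw [h, ← lintegral_indicator measurableSet_Ioi]
        refine lintegral_congr fun y => ?_
        simp [indicator, a]
    _ = _ := by
        rw [setLIntegral_Ioi_eq_inv hx]
        refine setLIntegral_congr_fun measurableSet_Ioo fun r hr => ?_
        have h0 := hr.1
        have h1 : 0 < 1 - r := by linarith [hr.2]
        have e1 : a / (a / r) = r := by field_simp
        have e2 : |a - a / r| = a * (1 - r) / r := by
          rw [abs_sub_comm, abs_of_pos]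
          · field_simp
          · have : a / r - a = a * (1 - r) / r := by field_simp
            rw [this]; positivity
        rw [e1, e2, mul_left_comm, ← ENNReal.ofReal_mul (by positivity)]
        congr 2
        field_simp

/-- The trivial factor `r ^ (1 - 1)` matches the form required by `hardy_of_kernel` with `N = 1`. -/
theorem setLIntegral_lt_lastCoord_mul_kernel {n : ℕ} (y : EuclideanSpace ℝ (Fin (n + 1)))
    (hy : 0 < y (Fin.last n)) {F : ℝ → ℝ≥0∞} (hF : Measurable F) :
    ∫⁻ x in {x : EuclideanSpace ℝ (Fin (n + 1)) | 0 < x (Fin.last n) ∧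
        x (Fin.last n) < y (Fin.last n)},
        F (x (Fin.last n) / y (Fin.last n)) * ENNReal.ofReal ((‖x - y‖ ^ (n + 1))⁻¹) =
      ∫⁻ r in Ioo 0 1, F r * ENNReal.ofReal (halfSpaceConst n * (1 - r)⁻¹ * r ^ ((1 : ℝ) - 1)) := by
  set b := y (Fin.last n)
  have hc := halfSpaceConst_pos n
  have h := lintegral_last_coord_mul_kernel y (F := (Ioo 0 b).indicator fun t => F (t / b))
    (Measurable.indicator (by fun_prop) measurableSet_Ioo)
  calc _ = ∫⁻ x : EuclideanSpace ℝ (Fin (n + 1)), (Ioo 0 b).indicator (fun t => F (t / b))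
        (x (Fin.last n)) * ENNReal.ofReal ((‖y - x‖ ^ (n + 1))⁻¹) := by
        have hl : Measurable fun x : EuclideanSpace ℝ (Fin (n + 1)) => x (Fin.last n) := by
          fun_prop
        have hm : MeasurableSet {x : EuclideanSpace ℝ (Fin (n + 1)) | 0 < x (Fin.last n) ∧
            x (Fin.last n) < b} :=
          (measurableSet_lt measurable_const hl).inter (measurableSet_lt hl measurable_const)
        rw [← lintegral_indicator hm]
        refine lintegral_congr fun x => ?_
        simp [indicator, norm_sub_rev]
    _ = ∫⁻ t in Ioo 0 b, F (t / b) * ENNReal.ofReal (halfSpaceConst n / |b - t|) := by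
        rw [h, ← lintegral_indicator measurableSet_Ioo]
        refine lintegral_congr fun y => ?_
        simp [indicator, b]
    _ = _ := by
        rw [setLIntegral_Ioo_eq_mul hy]
        refine setLIntegral_congr_fun measurableSet_Ioo fun r hr => ?_
        have h1 : 0 < 1 - r := by linarith [hr.2]
        have e1 : b * r / b = r := by field_simp
        have e2 : |b - b * r| = b * (1 - r) := by
          rw [abs_of_pos (by nlinarith)]; ring
        rw [e1, e2, mul_left_comm, ← ENNReal.ofReal_mul hy.le, sub_self, Real.rpow_zero]
        congr 2
        field_simp

/-! ### Identification of the constants and the two Hardy inequalities. -/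

theorem hardyCIntegrand_zero_eq {d : ℕ} (hd : 0 < d) {p α β : ℝ}
    (hαβ : α + β ∈ Ioo (0 : ℝ) d) (hp : 1 ≤ p) {r : ℝ} (hr : r ∈ Ioo (0 : ℝ) 1) :
    hardyCIntegrand d 0 p α β r = hardyWeight p (((d : ℝ) - α - β) / p) (-α) (-β) r *
      (unitSphereArea d * (1 - r ^ 2)⁻¹) := by
  have hγ : 0 < ((d : ℝ) - α - β) / p := div_pos (by linarith [hαβ.2]) (by linarith)
  rw [hardyCIntegrand, hardyPhi_zero_eq hd p hr, hardyWeight, zero_mul, sub_zero, zero_sub,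
    abs_of_pos (one_sub_rpow_mem hγ hr).1, neg_neg, neg_neg, Real.rpow_sub_one hr.1.ne',
    Real.rpow_sub_one hr.1.ne', Real.rpow_neg_one]
  ring

/-- Pulling `r ^ (-γ)` out of the absolute value yields `r ^ (-(1 + α + β))`, which turns `r ^ α`
into `r ^ (-β - 1)` and `r ^ β` into `r ^ (-α - 1)`. -/
theorem hardyDIntegrand_zero_eq {p α β : ℝ} (hαβ : α + β ∈ Ioo (-1 : ℝ) 0) (hp : 1 ≤ p)
    {r : ℝ} (hr : r ∈ Ioo (0 : ℝ) 1) :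
    hardyDIntegrand 0 p α β r = hardyWeight p ((1 + α + β) / p) α β r * (1 - r)⁻¹ := by
  have hp0 : 0 < p := by linarith
  set γ := (1 + α + β) / p with hγdef
  have hγ : 0 < γ := div_pos (by linarith [hαβ.1]) hp0
  have hγp : γ * p = 1 + α + β := by rw [hγdef]; field_simp
  have h0 := hr.1
  have h1 := (one_sub_rpow_mem hγ hr).1
  have e : |1 - r ^ (-γ)| ^ p = (1 - r ^ γ) ^ p * r ^ (-(1 + α + β)) := by
    have : 1 - r ^ (-γ) = -((1 - r ^ γ) * r ^ (-γ)) := by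
      rw [sub_mul, ← Real.rpow_add h0, add_neg_cancel, Real.rpow_zero]; ring
    have hg := Real.rpow_pos_of_pos h0 (-γ)
    rw [this, abs_neg, abs_of_pos (mul_pos h1 hg), Real.mul_rpow h1.le hg.le,
      ← Real.rpow_mul h0.le, neg_mul, hγp]
  have e1 : r ^ α * r ^ (-(1 + α + β)) = r ^ (-β - 1) := by
    rw [← Real.rpow_add h0]; congr 1; ring
  have e2 : r ^ β * r ^ (-(1 + α + β)) = r ^ (-α - 1) := by
    rw [← Real.rpow_add h0]; congr 1; ring
  rw [hardyDIntegrand, zero_mul, sub_zero, add_zero, Real.rpow_one, ← hγdef, e, hardyWeight,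
    ← e1, ← e2]
  ring

theorem intervalIntegral_congr_Ioo {f g : ℝ → ℝ} (h : ∀ r ∈ Ioo (0 : ℝ) 1, f r = g r) :
    ∫ r in (0 : ℝ)..1, f r = ∫ r in Ioo 0 1, g r := by
  rw [intervalIntegral.integral_of_le zero_le_one, integral_Ioc_eq_integral_Ioo]
  exact setIntegral_congr_fun measurableSet_Ioo h

/-- Finiteness of the right-hand integral, needed for the cancellation: `u` is bounded with bounded
support, and `‖x‖ ^ s` is locally integrable for `s > -d`. -/
theorem lintegral_norm_rpow_mul_norm_rpow_ne_top {E G : Type*} [NormedAddCommGroup E]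
    [InnerProductSpace ℝ E] [FiniteDimensional ℝ E] [Nontrivial E] [MeasurableSpace E]
    [BorelSpace E] [NormedAddCommGroup G] {u : E → G} (hu : Continuous u)
    (hc : HasCompactSupport u) {p s : ℝ} (hp : 0 < p) (hs : -(Module.finrank ℝ E : ℝ) < s) :
    ∫⁻ x : E, ENNReal.ofReal (‖u x‖ ^ p * ‖x‖ ^ s) ≠ ∞ := by
  obtain ⟨M, hM⟩ := hu.bounded_above_of_compact_support hc
  obtain ⟨R, hR0, hR⟩ := hc.isCompact.isBounded.subset_ball_lt 0 (0 : E)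
  have hint : IntegrableOn (fun x : E => M ^ p * ‖x‖ ^ s) (Metric.ball 0 R) := by
    rw [integrableOn_fun_norm_addHaar volume (f := fun t => M ^ p * t ^ s)]
    have h := ((intervalIntegral.integrableOn_Ioo_rpow_iff hR0
      (s := (Module.finrank ℝ E : ℝ) - 1 + s)).2 (by linarith)).const_mul (M ^ p)
    refine IntegrableOn.congr_fun h (fun t ht => ?_) measurableSet_Ioo
    have h1 : 1 ≤ Module.finrank ℝ E := Module.finrank_pos
    rw [Real.rpow_add ht.1, ← Nat.cast_one, ← Nat.cast_sub h1, Real.rpow_natCast, smul_eq_mul]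
    ring
  have hle : ∫⁻ x : E, ENNReal.ofReal (‖u x‖ ^ p * ‖x‖ ^ s) ≤
      ∫⁻ x in Metric.ball (0 : E) R, ENNReal.ofReal (M ^ p * ‖x‖ ^ s) := by
    rw [← lintegral_indicator measurableSet_ball]
    refine lintegral_mono fun x => ?_
    by_cases hx : x ∈ Metric.ball (0 : E) R
    · rw [indicator_of_mem hx]
      gcongr
      exact hM x
    · have : u x = 0 := image_eq_zero_of_notMem_tsupport fun h => hx (hR h)
      simp [this, Real.zero_rpow hp.ne']
  exact (hle.trans_lt hint.lintegral_lt_top).ne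

theorem hardy_euclidean {𝕜 : Type*} [RCLike 𝕜] {d : ℕ} (hd : 0 < d) {p α β : ℝ} (hp : 1 ≤ p)
    (hα : α ∈ Ioo (0 : ℝ) d) (hβ : β ∈ Ioo (0 : ℝ) d) (hαβ : α + β ∈ Ioo (0 : ℝ) d) :
    IntervalIntegrable (hardyCIntegrand d 0 p α β) volume 0 1 ∧
      hardyC d 0 p α β =
        2 * Real.pi ^ ((d : ℝ) / 2) / Real.Gamma ((d : ℝ) / 2) *
          ∫ r in (0 : ℝ)..1,
            (r ^ (α - 1) + r ^ (β - 1)) * (1 - r ^ (((d : ℝ) - α - β) / p)) ^ p / (1 - r ^ 2) ∧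
      ∀ u : EuclideanSpace ℝ (Fin d) → 𝕜, Continuous u → HasCompactSupport u →
        ENNReal.ofReal (hardyC d 0 p α β) *
            ∫⁻ x : EuclideanSpace ℝ (Fin d), ENNReal.ofReal (‖u x‖ ^ p / ‖x‖ ^ (α + β)) ≤
          ∫⁻ x : EuclideanSpace ℝ (Fin d), ∫⁻ y : EuclideanSpace ℝ (Fin d),
            ENNReal.ofReal (‖u x - u y‖ ^ p / ‖x - y‖ ^ d * ‖x‖ ^ (-α) * ‖y‖ ^ (-β)) := by
  have hp0 : 0 < p := by linarith
  have hfr : Module.finrank ℝ (EuclideanSpace ℝ (Fin d)) = d := by simp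
  have : Nontrivial (EuclideanSpace ℝ (Fin d)) :=
    Module.nontrivial_of_finrank_pos (R := ℝ) (by rw [hfr]; exact hd)
  have hγ : 0 < ((d : ℝ) - α - β) / p := div_pos (by linarith [hαβ.2]) hp0
  set m : ℝ → ℝ := fun r => unitSphereArea d * (1 - r ^ 2)⁻¹ with hm
  have hS : 0 ≤ unitSphereArea d := measureReal_nonneg
  have hm0 : ∀ r ∈ Ioo (0 : ℝ) 1, 0 ≤ m r := fun r hr => by
    have : 0 < 1 - r ^ 2 := by nlinarith [hr.1, hr.2]
    simp only [hm]; positivity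
  have hm1 : ∀ r ∈ Ioo (0 : ℝ) 1, m r ≤ unitSphereArea d / (1 - r) := fun r hr => by
    have h1 : 0 < 1 - r := by linarith [hr.2]
    have : 1 - r ≤ 1 - r ^ 2 := by nlinarith [hr.1, hr.2]
    simp only [hm, div_eq_mul_inv]
    gcongr
  have hC : hardyC d 0 p α β =
      ∫ r in Ioo 0 1, hardyWeight p (((d : ℝ) - α - β) / p) (-α) (-β) r * m r :=
    intervalIntegral_congr_Ioo fun r hr => hardyCIntegrand_zero_eq hd hαβ hp hr
  refine ⟨?_, ?_, fun u hu hc => ?_⟩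
  · rw [intervalIntegrable_iff_integrableOn_Ioo_of_le zero_le_one]
    exact (integrableOn_hardyWeight_mul hp hγ (neg_lt_zero.2 hα.1) (neg_lt_zero.2 hβ.1)
      (by fun_prop) hm0 hm1).congr_fun
      (fun r hr => (hardyCIntegrand_zero_eq hd hαβ hp hr).symm) measurableSet_Ioo
  · rw [hC, ← unitSphereArea_eq hd, intervalIntegral_congr_Ioo fun r _ => rfl,
      ← integral_const_mul]
    refine setIntegral_congr_fun measurableSet_Ioo fun r hr => ?_
    simp only [hm, hardyWeight, neg_neg]
    ring
  · have key := hardy_of_kernel (μ := (volume : Measure (EuclideanSpace ℝ (Fin d))))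
      (σ := fun x => ‖x‖) (k := fun x y => ENNReal.ofReal ((‖x - y‖ ^ d)⁻¹)) (m := m) (N := d)
      (a := -α) (b := -β) (f := fun x => ‖u x‖) (g := fun x y => ‖u x - u y‖) hp hγ
      (by field_simp; ring) (neg_lt_zero.2 hα.1) (neg_lt_zero.2 hβ.1) measurable_norm
      (by simp [ae_iff]) (by unfold Function.uncurry; fun_prop)
      (fun x y => by rw [norm_sub_rev]) (by fun_prop) hm0 hm1
      (fun x hx F hF => by
        have h := setLIntegral_norm_lt_mul_kernel x hx hF
        rwa [hfr] at h)
      (fun y hy F hF => by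
        have h := setLIntegral_lt_norm_mul_kernel y hy hF
        rwa [hfr] at h)
      hu.norm.measurable (fun x => norm_nonneg _)
      (Continuous.measurable (by unfold Function.uncurry; fun_prop)) (fun x y => norm_nonneg _)
      (fun x y => norm_sub_rev _ _) (fun x y => norm_le_norm_add_norm_sub' _ _)
      (lintegral_norm_rpow_mul_norm_rpow_ne_top hu hc hp0 (by rw [hfr]; linarith [hαβ.2]))
    rw [hC]
    convert key using 2
    · refine lintegral_congr fun x => ?_
      rw [← neg_add, Real.rpow_neg (norm_nonneg _), div_eq_mul_inv]
    · ext x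
      refine lintegral_congr fun y => ?_
      rw [← ENNReal.ofReal_mul (by positivity)]
      congr 1
      ring

theorem hardy_upperHalf {𝕜 : Type*} [RCLike 𝕜] {d : ℕ} (hd : 0 < d) {p α β : ℝ} (hp : 1 ≤ p)
    (hα : α ∈ Ioo (-1 : ℝ) 0) (hβ : β ∈ Ioo (-1 : ℝ) 0) (hαβ : α + β ∈ Ioo (-1 : ℝ) 0) :
    IntervalIntegrable (hardyDIntegrand 0 p α β) volume 0 1 ∧
      ∀ u : EuclideanSpace ℝ (Fin d) → 𝕜, Continuous u → HasCompactSupport u →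
        tsupport u ⊆ upperHalf hd →
        ENNReal.ofReal (hardyD d 0 p α β) *
            ∫⁻ x in upperHalf hd, ENNReal.ofReal (‖u x‖ ^ p * lastCoord hd x ^ (α + β)) ≤
          ∫⁻ x in upperHalf hd, ∫⁻ y in upperHalf hd,
            ENNReal.ofReal (‖u x - u y‖ ^ p / ‖x - y‖ ^ d *
              lastCoord hd x ^ α * lastCoord hd y ^ β) := by
  obtain ⟨n, rfl⟩ : ∃ n, d = n + 1 := ⟨d - 1, by omega⟩
  have hp0 : 0 < p := by linarith
  have hγ : 0 < (1 + α + β) / p := div_pos (by linarith [hαβ.1]) hp0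
  have hcn := halfSpaceConst_pos n
  set m : ℝ → ℝ := fun r => halfSpaceConst n * (1 - r)⁻¹ with hm
  have hm0 : ∀ r ∈ Ioo (0 : ℝ) 1, 0 ≤ m r := fun r hr => by
    have : 0 < 1 - r := by linarith [hr.2]
    simp only [hm]; positivity
  have hm1 : ∀ r ∈ Ioo (0 : ℝ) 1, m r ≤ halfSpaceConst n / (1 - r) := fun r hr => le_rfl
  have hD : hardyD (n + 1) 0 p α β =
      ∫ r in Ioo 0 1, hardyWeight p ((1 + α + β) / p) α β r * m r := by
    rw [hardyD, intervalIntegral_congr_Ioo fun r hr => hardyDIntegrand_zero_eq hαβ hp hr,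
      ← integral_const_mul]
    refine setIntegral_congr_fun measurableSet_Ioo fun r hr => ?_
    simp only [hm, halfSpaceConst, zero_mul, add_zero, Nat.cast_add, Nat.cast_one,
      add_sub_cancel_right]
    ring
  refine ⟨?_, fun u hu hc hsupp => ?_⟩
  · rw [intervalIntegrable_iff_integrableOn_Ioo_of_le zero_le_one]
    refine (integrableOn_hardyWeight_mul (m := fun r => (1 - r)⁻¹) (κ := 1) hp hγ hα.2 hβ.2
      (by fun_prop) (fun r hr => ?_) (fun r hr => ?_)).congr_fun
      (fun r hr => (hardyDIntegrand_zero_eq hαβ hp hr).symm) measurableSet_Ioo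
    · have : 0 < 1 - r := by linarith [hr.2]
      positivity
    · rw [one_div]
  · have hl : Measurable fun x : EuclideanSpace ℝ (Fin (n + 1)) => x (Fin.last n) := by fun_prop
    have hU : MeasurableSet (upperHalf hd) := measurableSet_lt measurable_const hl
    -- The compact support lies in the open half-space, so the weight is continuous and bounded on
    -- it.
    have hfin : ∫⁻ x in upperHalf hd,
        ENNReal.ofReal (‖u x‖ ^ p * x (Fin.last n) ^ (α + β)) ≠ ∞ := by
      have hcont : ContinuousOn (fun x : EuclideanSpace ℝ (Fin (n + 1)) =>
          ‖u x‖ ^ p * x (Fin.last n) ^ (α + β)) (tsupport u) := by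
        refine ContinuousOn.mul (hu.norm.rpow_const fun _ => .inr hp0.le).continuousOn ?_
        refine ContinuousOn.rpow_const (by fun_prop) fun x hx => .inl ?_
        have : 0 < x (Fin.last n) := hsupp hx
        exact this.ne'
      obtain ⟨C, hC⟩ := hc.isCompact.exists_bound_of_continuousOn hcont
      have hle : ∫⁻ x in upperHalf hd, ENNReal.ofReal (‖u x‖ ^ p * x (Fin.last n) ^ (α + β)) ≤
          ∫⁻ _ in tsupport u, ENNReal.ofReal C := by
        refine (setLIntegral_le_lintegral _ _).trans ?_
        rw [← lintegral_indicator hc.isCompact.measurableSet]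
        refine lintegral_mono fun x => ?_
        by_cases hx : x ∈ tsupport u
        · rw [indicator_of_mem hx]
          exact ENNReal.ofReal_le_ofReal ((le_abs_self _).trans (hC x hx))
        · have : u x = 0 := image_eq_zero_of_notMem_tsupport hx
          simp [this, Real.zero_rpow hp0.ne']
      refine (hle.trans_lt ?_).ne
      rw [setLIntegral_const]
      exact ENNReal.mul_lt_top ENNReal.ofReal_lt_top hc.isCompact.measure_lt_top
    have key := hardy_of_kernel (μ := volume.restrict (upperHalf hd))
      (σ := fun x => x (Fin.last n)) (k := fun x y => ENNReal.ofReal ((‖x - y‖ ^ (n + 1))⁻¹))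
      (m := m) (N := 1)
      (a := α) (b := β) (f := fun x => ‖u x‖) (g := fun x y => ‖u x - u y‖) hp hγ
      (by field_simp) hα.2 hβ.2 hl
      (ae_restrict_mem hU) (by unfold Function.uncurry; fun_prop)
      (fun x y => by rw [norm_sub_rev]) (by fun_prop) hm0 hm1
      -- Points higher than a point of the half-space are already in it, so the restriction of the
      -- measure is harmless.
      (fun x hx F hF => by
        rw [Measure.restrict_restrict (measurableSet_lt measurable_const hl),
          inter_eq_left.2 (show {y : EuclideanSpace ℝ (Fin (n + 1)) |
            x (Fin.last n) < y (Fin.last n)} ⊆ upperHalf hd from fun y hy => hx.trans hy)]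
        exact setLIntegral_lastCoord_lt_mul_kernel x hx hF)
      (fun y hy F hF => by
        have hS : MeasurableSet {x : EuclideanSpace ℝ (Fin (n + 1)) |
            0 < x (Fin.last n) ∧ x (Fin.last n) < y (Fin.last n)} :=
          (measurableSet_lt measurable_const hl).inter (measurableSet_lt hl measurable_const)
        rw [Measure.restrict_restrict hS, inter_eq_left.2 (show {x : EuclideanSpace ℝ (Fin (n + 1)) |
            0 < x (Fin.last n) ∧ x (Fin.last n) < y (Fin.last n)} ⊆ upperHalf hd from
            fun x hx => hx.1)]
        exact setLIntegral_lt_lastCoord_mul_kernel y hy hF)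
      hu.norm.measurable (fun x => norm_nonneg _)
      (Continuous.measurable (by unfold Function.uncurry; fun_prop)) (fun x y => norm_nonneg _)
      (fun x y => norm_sub_rev _ _) (fun x y => norm_le_norm_add_norm_sub' _ _) hfin
    rw [hD]
    refine key.trans_eq ?_
    refine setLIntegral_congr_fun hU fun x hx => setLIntegral_congr_fun hU fun y hy => ?_
    have hx' : 0 < x (Fin.last n) := hx
    have hy' : 0 < y (Fin.last n) := hy
    change _ = ENNReal.ofReal (‖u x - u y‖ ^ p / ‖x - y‖ ^ (n + 1) *
      x (Fin.last n) ^ α * y (Fin.last n) ^ β)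
    rw [← ENNReal.ofReal_mul (by positivity)]
    congr 1
    ring

theorem corollary1p7 {𝕜 : Type*} [RCLike 𝕜] (d : ℕ) (hd : 0 < d) (p : ℝ) (hp : 1 ≤ p)
    (α β : ℝ) :
    (α ∈ Ioo (0 : ℝ) d → β ∈ Ioo (0 : ℝ) d → α + β ∈ Ioo (0 : ℝ) d →
      IntervalIntegrable (hardyCIntegrand d 0 p α β) volume 0 1 ∧
      hardyC d 0 p α β =
        2 * Real.pi ^ ((d : ℝ) / 2) / Real.Gamma ((d : ℝ) / 2) *
          ∫ r in (0 : ℝ)..1,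
            (r ^ (α - 1) + r ^ (β - 1)) * (1 - r ^ (((d : ℝ) - α - β) / p)) ^ p / (1 - r ^ 2) ∧
      ∀ u : EuclideanSpace ℝ (Fin d) → 𝕜, Continuous u → HasCompactSupport u →
        ENNReal.ofReal (hardyC d 0 p α β) *
            ∫⁻ x : EuclideanSpace ℝ (Fin d), ENNReal.ofReal (‖u x‖ ^ p / ‖x‖ ^ (α + β)) ≤
          ∫⁻ x : EuclideanSpace ℝ (Fin d), ∫⁻ y : EuclideanSpace ℝ (Fin d),
            ENNReal.ofReal (‖u x - u y‖ ^ p / ‖x - y‖ ^ d * ‖x‖ ^ (-α) * ‖y‖ ^ (-β))) ∧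
    (α ∈ Ioo (-1 : ℝ) 0 → β ∈ Ioo (-1 : ℝ) 0 → α + β ∈ Ioo (-1 : ℝ) 0 →
      IntervalIntegrable (hardyDIntegrand 0 p α β) volume 0 1 ∧
      ∀ u : EuclideanSpace ℝ (Fin d) → 𝕜, Continuous u → HasCompactSupport u →
        tsupport u ⊆ upperHalf hd →
        ENNReal.ofReal (hardyD d 0 p α β) *
            ∫⁻ x in upperHalf hd, ENNReal.ofReal (‖u x‖ ^ p * lastCoord hd x ^ (α + β)) ≤
          ∫⁻ x in upperHalf hd, ∫⁻ y in upperHalf hd,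
            ENNReal.ofReal (‖u x - u y‖ ^ p / ‖x - y‖ ^ d *
              lastCoord hd x ^ α * lastCoord hd y ^ β)) :=
  ⟨fun hα hβ hαβ => hardy_euclidean hd hp hα hβ hαβ,
    fun hα hβ hαβ => hardy_upperHalf hd hp hα hβ hαβ⟩
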